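/- Let $X_1,X_2,\dots$ be i.i.d. real random variables with $\mathbb E X_1=0$ and $\operatorname{Var}(X_1)=1$, and let $S(n)=\sum_{i=1}^n X_i$ for $n\ge 0$ (so $S(0)=0$). For $N\in\mathbb N$ let $$\operatorname{LIS}(S|_{[0,N)})=\max\{|A| : A\subset\{0,1,\dots,N-1\},\ S(a)\le S(b)\text{ for all }a,b\in A\text{ with }a\le b\}$$ be the maximal length of a weakly increasing subsequence of $S(0),\dots,S(N-1)$. Then there is an $n_0$ such that for all integers $n\ge n_0$ and all integers $\ell\ge 1$, $$\mathbb P\Big(\operatorname{LIS}(S|_{[0,4^n)})\ge \ell\, 2^{\,n+4\sqrt{n\log_2 n}}\Big)\le \Big(\frac{2}{n^2}\Big)^{\ell}.$$ Moreover, if $\mathbb E e^{t|X_1|}<\infty$ for some $t>0$, then there is an $n_0$ such that for all integers $n\ge n_0$ and all integers $\ell\ge 1$, $$\mathbb P\Big(\operatorname{LIS}(S|_{[0,4^n)})\ge \ell\, 2^{\,n+4\sqrt{n\log_2 n}}\Big)\le 2^{-\ell n}.$$ -/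

import Mathlib

open MeasureTheory ProbabilityTheory

noncomputable section

/-- The random walk with increments `X 0, X 1, X 2, …`: it starts at `0`, and its value at time `n`
is the sum of the first `n` increments. The increments are numbered from `0`. -/
def randomWalk {Ω : Type*} (X : ℕ → Ω → ℝ) (n : ℕ) (ω : Ω) : ℝ :=
  ∑ i ∈ Finset.range n, X i ω

open Classical in
/-- The largest cardinality of a set `A` of times in `I` along which `S` is weakly increasing.
The empty set of times is always admissible, so the supremum of cardinalities is a maximum. -/
def LIS (S : ℕ → ℝ) (I : Finset ℕ) : ℕ :=
  (I.powerset.filter (fun A : Finset ℕ => MonotoneOn S (A : Set ℕ))).sup Finset.card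

end

/-!
Both estimates follow from the stronger bound `2 ^ (-n)` for `ℓ = 1`, valid under a finite second
moment alone.

*Submultiplicativity.* Cutting at the first time the longest increasing subsequence reaches length
`x` gives `P (LIS ≥ ℓ * x) ≤ P (LIS ≥ x) ^ ℓ` (`measureReal_le_LIS_pow`). It therefore suffices to
show `P (LIS ≥ x) ≤ 1 / 2` for some `x` with `n * x ≤ 2 ^ (n + 4 √(n log₂ n))`.

*Regular paths.* With probability at least `1 / 2` the path is regular in the following sense
(`exists_measureReal_not_isRegularPath_le`): it stays within `6 * 2 ^ n` of the origin, and, for all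
`j`, from any of its points on, the window of radius `2 ^ j` around this point is visited in at most
`C * n * 2 ^ k` of the next `4 ^ k` time blocks of length `4 ^ j`. The first property is a maximal
inequality. For the second, a characteristic function estimate bounds the probability of being near
the starting point after `d` blocks by `O (1 / √d)` (`exists_concentration`), so the expected number
of visited blocks is `O (2 ^ k)`; restarting the walk repeatedly yields an exponential tail
(`measureReal_card_visitedBlocks_le_pow`), which survives a union bound over all `4 ^ n` starting
points.

*Regular paths have short increasing subsequences.* Let `S` be monotone on `A`. A block of length
`4 ^ (j + k)` on which `S|_A` rises by at most `2 ^ j` has at most `C * n * 2 ^ k` sub-blocks of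
length `4 ^ j` meeting `A`, by regularity. The rises over different blocks add up to at most
`O (2 ^ n)`, so only `O (2 ^ (n - j))` blocks have a larger rise, and these have at most `4 ^ k`
sub-blocks each (`blockCount_le_of_visitedBlocks`). If `a j` is the number of blocks of length
`4 ^ j` meeting `A`, divided by `2 ^ (n - j)`, then `a j ≤ C * n * a (j + k) + O (4 ^ k)`. Iterating
`n / k` times gives `|A| ≤ 14 * 2 ^ n * 8 ^ k * (C * n) ^ (n / k)` (`IsRegularPath.LIS_le`), and
`k ≈ √(n log₂ n) / 2` makes this `2 ^ (n + (7 / 2 + o(1)) √(n log₂ n))`.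
-/

namespace RandomWalkLIS

/-! ### First-passage decomposition -/

section FirstPassage

variable {Ω : Type*}

/-- The σ-algebra generated by the increments before time `t`. -/
abbrev past (X : ℕ → Ω → ℝ) (t : ℕ) : MeasurableSpace Ω :=
  ⨆ i ∈ Set.Iio t, MeasurableSpace.comap (X i) inferInstance

/-- The σ-algebra generated by the increments from time `t` on. -/
abbrev future (X : ℕ → Ω → ℝ) (t : ℕ) : MeasurableSpace Ω :=
  ⨆ i ∈ Set.Ici t, MeasurableSpace.comap (X i) inferInstance

lemma past_mono (X : ℕ → Ω → ℝ) : Monotone (past X) := fun _ _ hst =>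
  biSup_mono fun _ hi => lt_of_lt_of_le hi hst

lemma measurable_past_increment (X : ℕ → Ω → ℝ) {i t : ℕ} (h : i < t) :
    Measurable[past X t] (X i) := by
  have h1 : MeasurableSpace.comap (X i) inferInstance ≤ past X t :=
    le_biSup (fun i => MeasurableSpace.comap (X i) inferInstance) (show i ∈ Set.Iio t from h)
  exact (comap_measurable (X i)).mono h1 le_rfl

lemma measurable_future_increment (X : ℕ → Ω → ℝ) {i t : ℕ} (h : t ≤ i) :
    Measurable[future X t] (X i) := by
  have h1 : MeasurableSpace.comap (X i) inferInstance ≤ future X t :=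
    le_biSup (fun i => MeasurableSpace.comap (X i) inferInstance) (show i ∈ Set.Ici t from h)
  exact (comap_measurable (X i)).mono h1 le_rfl

lemma measurable_past_randomWalk (X : ℕ → Ω → ℝ) {u t : ℕ} (h : u ≤ t) :
    Measurable[past X t] (randomWalk X u) := by
  unfold randomWalk
  refine @Finset.measurable_fun_sum _ _ _ _ _ _ (past X t) _ _ fun i hi => ?_
  exact measurable_past_increment X ((Finset.mem_range.1 hi).trans_le h)

lemma randomWalk_sub (X : ℕ → Ω → ℝ) {t u : ℕ} (h : t ≤ u) (ω : Ω) :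
    randomWalk X u ω - randomWalk X t ω = ∑ i ∈ Finset.Ico t u, X i ω := by
  rw [randomWalk, randomWalk, Finset.sum_Ico_eq_sub _ h]

lemma measurable_future_randomWalk_sub (X : ℕ → Ω → ℝ) {t u : ℕ} (h : t ≤ u) :
    Measurable[future X t] (fun ω => randomWalk X u ω - randomWalk X t ω) := by
  simp_rw [randomWalk_sub X h]
  refine @Finset.measurable_fun_sum _ _ _ _ _ _ (future X t) _ _ fun i hi => ?_
  exact measurable_future_increment X (Finset.mem_Ico.1 hi).1

variable [MeasurableSpace Ω]

lemma past_le {X : ℕ → Ω → ℝ} (hmeas : ∀ i, Measurable (X i)) (t : ℕ) :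
    past X t ≤ ‹MeasurableSpace Ω› :=
  iSup₂_le fun i _ => (hmeas i).comap_le

lemma measurable_randomWalk {X : ℕ → Ω → ℝ} (hmeas : ∀ i, Measurable (X i)) (t : ℕ) :
    Measurable (randomWalk X t) :=
  (measurable_past_randomWalk X le_rfl).mono (past_le hmeas t) le_rfl

lemma indep_past_future {P : Measure Ω} {X : ℕ → Ω → ℝ} (hmeas : ∀ i, Measurable (X i))
    (hindep : iIndepFun X P) (t : ℕ) : Indep (past X t) (future X t) P := by
  refine indep_iSup_of_disjoint (fun i => (hmeas i).comap_le) hindep ?_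
  rw [Set.disjoint_left]
  intro i hi hi'
  exact absurd (Set.mem_Iio.1 hi) (not_lt.2 hi')

/-- The form of the strong Markov property used throughout. If `G` forces some `E t` with `t < N` to
occur, and forces `F t` at the first such time `t`, where `E t` depends on the past of `t` and
`F t` on its future, then `P G ≤ sup P (F t) * P (⋃ E t)`. -/
lemma measureReal_le_of_first_passage {P : Measure Ω} [IsProbabilityMeasure P]
    {X : ℕ → Ω → ℝ} (hmeas : ∀ i, Measurable (X i)) (hindep : iIndepFun X P)
    {E F : ℕ → Set Ω} {G H : Set Ω} {N : ℕ} {p : ℝ} (hp : 0 ≤ p)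
    (hE : ∀ t < N, MeasurableSet[past X t] (E t))
    (hF : ∀ t < N, MeasurableSet[future X t] (F t))
    (hFp : ∀ t < N, P.real (F t) ≤ p)
    (hEH : ∀ t < N, E t ⊆ H)
    (hGE : ∀ ω ∈ G, ∃ t < N, ω ∈ E t)
    (hGF : ∀ ω ∈ G, ∀ t < N, ω ∈ E t → (∀ s < t, ω ∉ E s) → ω ∈ F t) :
    P.real G ≤ p * P.real H := by
  classical
  set D : ℕ → Set Ω := fun t => E t \ ⋃ s ∈ Finset.range t, E s with hD
  have hDmeas : ∀ t < N, MeasurableSet[past X t] (D t) := by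
    intro t ht
    refine MeasurableSet.diff (hE t ht) ?_
    refine Finset.measurableSet_biUnion _ fun s hs => ?_
    have hst := Finset.mem_range.1 hs
    exact past_mono X hst.le _ (hE s (hst.trans ht))
  have hDdisj : Set.PairwiseDisjoint (↑(Finset.range N)) D := by
    intro a _ b _ hab
    rw [Function.onFun, Set.disjoint_left]
    rintro ω ⟨ha, ha'⟩ ⟨hb, hb'⟩
    rcases lt_or_gt_of_ne hab with h | h
    · exact hb' (Set.mem_biUnion (Finset.mem_coe.2 (Finset.mem_range.2 h)) ha)
    · exact ha' (Set.mem_biUnion (Finset.mem_coe.2 (Finset.mem_range.2 h)) hb)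
  have hcover : G ⊆ ⋃ t ∈ Finset.range N, D t ∩ F t := by
    intro ω hω
    have hex := hGE ω hω
    have hspec := Nat.find_spec hex
    have hmin : ∀ s < Nat.find hex, ω ∉ E s := fun s hs hs' =>
      Nat.find_min hex hs ⟨hs.trans hspec.1, hs'⟩
    refine Set.mem_biUnion (Finset.mem_coe.2 (Finset.mem_range.2 hspec.1)) ⟨⟨hspec.2, ?_⟩, ?_⟩
    · simp only [Set.mem_iUnion, not_exists, Finset.mem_range]
      exact fun s hs => hmin s hs
    · exact hGF ω hω _ hspec.1 hspec.2 hmin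
  calc P.real G ≤ P.real (⋃ t ∈ Finset.range N, D t ∩ F t) := measureReal_mono hcover (measure_ne_top _ _)
    _ ≤ ∑ t ∈ Finset.range N, P.real (D t ∩ F t) := measureReal_biUnion_finset_le _ _
    _ ≤ ∑ t ∈ Finset.range N, p * P.real (D t) := by
        refine Finset.sum_le_sum fun t ht => ?_
        have ht := Finset.mem_range.1 ht
        have h := (Indep_iff _ _ P).1 (indep_past_future hmeas hindep t) _ _ (hDmeas t ht) (hF t ht)
        rw [measureReal_def, h, ENNReal.toReal_mul, mul_comm]
        exact mul_le_mul_of_nonneg_right (hFp t ht) ENNReal.toReal_nonneg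
    _ = p * P.real (⋃ t ∈ Finset.range N, D t) := by
        rw [← Finset.mul_sum, measureReal_biUnion_finset hDdisj]
        intro t ht
        exact past_le hmeas t _ (hDmeas t (Finset.mem_range.1 ht))
    _ ≤ p * P.real H := by
        refine mul_le_mul_of_nonneg_left (measureReal_mono ?_) hp
        refine Set.iUnion₂_subset fun t ht => Set.sdiff_subset.trans ?_
        exact hEH t (Finset.mem_range.1 ht)

end FirstPassage

/-! ### Subadditivity of the longest increasing subsequence -/

section LIS

lemma card_le_LIS {S : ℕ → ℝ} {I A : Finset ℕ} (hA : A ⊆ I) (hS : MonotoneOn S (A : Set ℕ)) :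
    A.card ≤ LIS S I := by
  classical
  unfold LIS
  exact Finset.le_sup (f := Finset.card)
    (Finset.mem_filter.2 ⟨Finset.mem_powerset.2 hA, hS⟩)

lemma exists_card_eq_LIS (S : ℕ → ℝ) (I : Finset ℕ) :
    ∃ A ⊆ I, MonotoneOn S (A : Set ℕ) ∧ A.card = LIS S I := by
  classical
  have hne : (I.powerset.filter (fun A : Finset ℕ => MonotoneOn S (A : Set ℕ))).Nonempty :=
    ⟨∅, Finset.mem_filter.2 ⟨Finset.empty_mem_powerset _, by simp [MonotoneOn]⟩⟩
  obtain ⟨A, hA, h⟩ := Finset.exists_mem_eq_sup _ hne Finset.card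
  obtain ⟨h1, h2⟩ := Finset.mem_filter.1 hA
  exact ⟨A, Finset.mem_powerset.1 h1, h2, by rw [LIS, h]⟩

lemma LIS_empty (S : ℕ → ℝ) : LIS S ∅ = 0 := by
  obtain ⟨A, hA, -, hc⟩ := exists_card_eq_LIS S ∅
  rw [← hc, Finset.subset_empty.1 hA, Finset.card_empty]

lemma LIS_mono (S : ℕ → ℝ) {I J : Finset ℕ} (h : I ⊆ J) : LIS S I ≤ LIS S J := by
  obtain ⟨A, hA, hS, hc⟩ := exists_card_eq_LIS S I
  exact hc ▸ card_le_LIS (hA.trans h) hS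

lemma LIS_union_le (S : ℕ → ℝ) (I J : Finset ℕ) : LIS S (I ∪ J) ≤ LIS S I + LIS S J := by
  obtain ⟨A, hA, hS, hc⟩ := exists_card_eq_LIS S (I ∪ J)
  have h : A = (A ∩ I) ∪ (A ∩ J) := by
    rw [← Finset.inter_union_distrib_left, Finset.inter_eq_left.2 hA]
  calc LIS S (I ∪ J) = ((A ∩ I) ∪ (A ∩ J)).card := by rw [← hc, ← h]
    _ ≤ (A ∩ I).card + (A ∩ J).card := Finset.card_union_le _ _
    _ ≤ _ := add_le_add
        (card_le_LIS Finset.inter_subset_right (hS.mono (by simp)))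
        (card_le_LIS Finset.inter_subset_right (hS.mono (by simp)))

lemma measurableSet_le_LIS {Ω : Type*} {m : MeasurableSpace Ω} {S : ℕ → Ω → ℝ} {I : Finset ℕ}
    (h : ∀ a ∈ I, ∀ b ∈ I, a ≤ b → MeasurableSet[m] {ω | S a ω ≤ S b ω}) (x : ℝ) :
    MeasurableSet[m] {ω | x ≤ (LIS (fun j => S j ω) I : ℝ)} := by
  classical
  have heq : {ω | x ≤ (LIS (fun j => S j ω) I : ℝ)} =
      ⋃ A ∈ I.powerset.filter (fun A => x ≤ (A.card : ℝ)),
        ⋂ a ∈ A, ⋂ b ∈ A.filter (fun b => a ≤ b), {ω | S a ω ≤ S b ω} := by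
    ext ω
    simp only [Set.mem_ofPred_eq, Set.mem_iUnion, Set.mem_iInter, Finset.mem_filter,
      Finset.mem_powerset, exists_prop]
    constructor
    · intro hx
      obtain ⟨A, hA, hS, hc⟩ := exists_card_eq_LIS (fun j => S j ω) I
      exact ⟨A, ⟨hA, hc ▸ hx⟩, fun a ha b hb => hS ha hb.1 hb.2⟩
    · rintro ⟨A, ⟨hA, hx⟩, hS⟩
      refine hx.trans (Nat.cast_le.2 (card_le_LIS hA ?_))
      exact fun a ha b hb hab => hS a ha b ⟨hb, hab⟩
  rw [heq]
  refine Finset.measurableSet_biUnion _ fun A hA => ?_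
  have hAI := Finset.mem_powerset.1 (Finset.mem_filter.1 hA).1
  refine Finset.measurableSet_biInter _ fun a ha => ?_
  refine Finset.measurableSet_biInter _ fun b hb => ?_
  exact h a (hAI ha) b (hAI (Finset.mem_filter.1 hb).1) (Finset.mem_filter.1 hb).2

variable {Ω : Type*} [MeasurableSpace Ω]

/-- Splitting at the first time the increasing subsequence reaches length `x` shows that its
length has a submultiplicative tail. -/
lemma measureReal_le_LIS_pow {P : Measure Ω} [IsProbabilityMeasure P]
    {X : ℕ → Ω → ℝ} (hmeas : ∀ i, Measurable (X i)) (hindep : iIndepFun X P)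
    (N : ℕ) {x : ℝ} (hx : 0 < x) (ℓ : ℕ) :
    P.real {ω | ℓ * x ≤ (LIS (fun j => randomWalk X j ω) (Finset.range N) : ℝ)} ≤
      P.real {ω | x ≤ (LIS (fun j => randomWalk X j ω) (Finset.range N) : ℝ)} ^ ℓ := by
  induction ℓ with
  | zero => simp
  | succ ℓ ih =>
    rw [pow_succ]
    refine le_trans ?_ (mul_le_mul_of_nonneg_right ih measureReal_nonneg)
    refine measureReal_le_of_first_passage hmeas hindep measureReal_nonneg (N := N)
      (E := fun t => {ω | x ≤ (LIS (fun j => randomWalk X j ω) (Finset.range (t + 1)) : ℝ)})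
      (F := fun t => {ω | ℓ * x ≤ (LIS (fun j => randomWalk X j ω) (Finset.Ico t N) : ℝ)})
      ?_ ?_ ?_ ?_ ?_ ?_
    · intro t _
      refine measurableSet_le_LIS (fun a ha b hb _ => ?_) x
      exact @measurableSet_le _ _ _ _ _ (past X t) _ _ _ _ _
        (measurable_past_randomWalk X (Nat.lt_succ_iff.1 (Finset.mem_range.1 ha)))
        (measurable_past_randomWalk X (Nat.lt_succ_iff.1 (Finset.mem_range.1 hb)))
    · intro t _
      refine measurableSet_le_LIS (fun a ha b hb _ => ?_) _
      have h := @measurableSet_le _ _ _ _ _ (future X t) _ _ _ _ _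
        (measurable_future_randomWalk_sub X (Finset.mem_Ico.1 ha).1)
        (measurable_future_randomWalk_sub X (Finset.mem_Ico.1 hb).1)
      simpa using h
    · intro t _
      refine measureReal_mono fun ω hω => ?_
      refine le_trans (show (ℓ : ℝ) * x ≤ _ from hω) (Nat.cast_le.2 (LIS_mono _ ?_))
      exact fun a ha => Finset.mem_range.2 (Finset.mem_Ico.1 ha).2
    · intro t ht ω hω
      refine le_trans (show x ≤ _ from hω) (Nat.cast_le.2 (LIS_mono _ ?_))
      exact Finset.range_mono ht
    · intro ω hω
      have hω' : x ≤ (LIS (fun j => randomWalk X j ω) (Finset.range N) : ℝ) := by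
        refine le_trans ?_ (show ((ℓ + 1 : ℕ) : ℝ) * x ≤ _ from hω)
        push_cast
        nlinarith [mul_nonneg (Nat.cast_nonneg (α := ℝ) ℓ) hx.le]
      rcases Nat.eq_zero_or_pos N with rfl | hN
      · exact absurd hω' (by simpa [LIS_empty] using hx)
      · refine ⟨N - 1, by omega, ?_⟩
        simpa [Nat.sub_add_cancel hN] using hω'
    · intro ω hω t ht _ hmin
      have hlt : (LIS (fun j => randomWalk X j ω) (Finset.range t) : ℝ) < x := by
        rcases Nat.eq_zero_or_pos t with rfl | htp
        · simpa [LIS_empty] using hx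
        · have := hmin (t - 1) (by omega)
          simpa [Nat.sub_add_cancel htp] using this
      have hle : (LIS (fun j => randomWalk X j ω) (Finset.range N) : ℝ) ≤
          LIS (fun j => randomWalk X j ω) (Finset.range t) +
          LIS (fun j => randomWalk X j ω) (Finset.Ico t N) := by
        have hU : Finset.range N = Finset.range t ∪ Finset.Ico t N := by
          ext a
          simp only [Finset.mem_range, Finset.mem_union, Finset.mem_Ico]
          omega
        rw [hU]
        exact_mod_cast LIS_union_le _ _ _
      have hω' : ((ℓ + 1 : ℕ) : ℝ) * x ≤ _ := hω
      push_cast at hω'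
      show (ℓ : ℝ) * x ≤ _
      linarith

end LIS

/-! ### A concentration inequality from the characteristic function -/

section Concentration

open intervalIntegral

lemma integral_one_sub_mul_cos {x : ℝ} (hx : x ≠ 0) :
    ∫ t in (0 : ℝ)..1, (1 - t) * Real.cos (t * x) = (1 - Real.cos x) / x ^ 2 := by
  have h : ∀ t ∈ Set.uIcc (0 : ℝ) 1,
      HasDerivAt (fun t => (1 - t) * Real.sin (t * x) / x - Real.cos (t * x) / x ^ 2)
        ((1 - t) * Real.cos (t * x)) t := by
    intro t _
    have h1 : HasDerivAt (fun t : ℝ => t * x) x t := by simpa using (hasDerivAt_id t).mul_const x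
    have h2 : HasDerivAt (fun t : ℝ => 1 - t) (-1) t := by
      simpa using (hasDerivAt_id t).const_sub 1
    convert! ((h2.mul h1.sin).div_const x).sub (h1.cos.div_const (x ^ 2)) using 1
    field_simp
    ring
  rw [integral_eq_sub_of_hasDerivAt h (Continuous.intervalIntegrable (by fun_prop) _ _)]
  simp
  ring

/-- The Fejér kernel, as a cosine transform of the triangle function, is nonnegative. -/
lemma integral_one_sub_mul_cos_nonneg (x : ℝ) :
    0 ≤ ∫ t in (0 : ℝ)..1, (1 - t) * Real.cos (t * x) := by
  by_cases hx : x = 0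
  · subst hx
    refine integral_nonneg zero_le_one fun t ht => ?_
    simpa using ht.2
  · rw [integral_one_sub_mul_cos hx]
    exact div_nonneg (sub_nonneg.2 (Real.cos_le_one x)) (sq_nonneg x)

lemma quarter_le_integral_one_sub_mul_cos {x : ℝ} (hx : |x| ≤ 1) :
    1 / 4 ≤ ∫ t in (0 : ℝ)..1, (1 - t) * Real.cos (t * x) := by
  have h1 : ∫ t in (0 : ℝ)..1, (1 - t) * (1 / 2) = 1 / 4 := by
    rw [intervalIntegral.integral_mul_const, intervalIntegral.integral_sub (by simp) (by simp)]
    norm_num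
  rw [← h1]
  refine integral_mono_on zero_le_one (Continuous.intervalIntegrable (by fun_prop) _ _)
    (Continuous.intervalIntegrable (by fun_prop) _ _) fun t ht => ?_
  refine mul_le_mul_of_nonneg_left ?_ (by linarith [ht.2])
  have h2 := Real.one_sub_sq_div_two_le_cos (x := t * x)
  have h3 : (t * x) ^ 2 ≤ 1 := by
    rw [sq_le_one_iff_abs_le_one, abs_mul, abs_of_nonneg ht.1]
    exact mul_le_one₀ ht.2 (abs_nonneg _) hx
  linarith

variable {Ω : Type*} [MeasurableSpace Ω]

lemma isFiniteMeasure_restrict_uIoc : IsFiniteMeasure (volume.restrict (Set.uIoc (0 : ℝ) 1)) := by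
  rw [Set.uIoc_of_le zero_le_one]
  infer_instance

lemma intervalIntegrable_norm_charFun_div (μ : Measure ℝ) [IsProbabilityMeasure μ] (r : ℝ) :
    IntervalIntegrable (fun t => ‖charFun μ (t / r)‖) volume 0 1 := by
  have := isFiniteMeasure_restrict_uIoc
  rw [intervalIntegrable_iff]
  refine Integrable.of_bound (C := 1) ?_ (Filter.Eventually.of_forall fun t => ?_)
  · exact ((measurable_charFun.comp (measurable_id.div_const r)).norm).aestronglyMeasurable
  · rw [norm_norm]
    exact norm_charFun_le_one _

lemma integral_cos_le_norm_charFun {P : Measure Ω} [IsProbabilityMeasure P] {Y : Ω → ℝ}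
    (hY : Measurable Y) (t : ℝ) :
    ∫ ω, Real.cos (t * Y ω) ∂P ≤ ‖charFun (P.map Y) t‖ := by
  have h : charFun (P.map Y) t = ∫ ω, Complex.exp (t * Y ω * Complex.I) ∂P := by
    rw [charFun_apply_real, integral_map hY.aemeasurable]
    exact Continuous.aestronglyMeasurable (by fun_prop)
  have hint : Integrable (fun ω => Complex.exp (t * Y ω * Complex.I)) P := by
    refine Integrable.of_bound (C := 1) (Measurable.aestronglyMeasurable (by fun_prop)) ?_
    refine Filter.Eventually.of_forall fun ω => ?_
    rw [← Complex.ofReal_mul, Complex.norm_exp_ofReal_mul_I]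
  have h2 : ∫ ω, Real.cos (t * Y ω) ∂P = (charFun (P.map Y) t).re := by
    rw [h, ← RCLike.re_eq_complex_re, ← integral_re hint]
    congr 1 with ω
    rw [RCLike.re_eq_complex_re, ← Complex.ofReal_mul, Complex.exp_ofReal_mul_I_re]
  rw [h2]
  exact Complex.re_le_norm _

/-- An inequality of Esseen type, for intervals centred at the origin. -/
lemma measureReal_abs_le_le_integral_charFun {P : Measure Ω} [IsProbabilityMeasure P] {Y : Ω → ℝ}
    (hY : Measurable Y) {ρ : ℝ} (hρ : 0 < ρ) :
    P.real {ω | |Y ω| ≤ ρ} ≤ 4 * ∫ t in (0 : ℝ)..1, ‖charFun (P.map Y) (t / ρ)‖ := by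
  have := isFiniteMeasure_restrict_uIoc
  have hg : Integrable (fun p : ℝ × Ω => (1 - p.1) * Real.cos (p.1 * (Y p.2 / ρ)))
      ((volume.restrict (Set.uIoc (0 : ℝ) 1)).prod P) := by
    have hb : ∀ᵐ p : ℝ × Ω ∂((volume.restrict (Set.uIoc (0 : ℝ) 1)).prod P),
        ‖(1 - p.1) * Real.cos (p.1 * (Y p.2 / ρ))‖ ≤ 1 := by
      have h1 : ∀ᵐ t ∂(volume.restrict (Set.uIoc (0 : ℝ) 1)), t ∈ Set.uIoc (0 : ℝ) 1 :=
        ae_restrict_mem measurableSet_uIoc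
      have h2 : ∀ᵐ p : ℝ × Ω ∂((volume.restrict (Set.uIoc (0 : ℝ) 1)).prod P),
          p.1 ∈ Set.uIoc (0 : ℝ) 1 := Measure.quasiMeasurePreserving_fst.ae h1
      filter_upwards [h2] with p hp
      rw [Set.uIoc_of_le zero_le_one] at hp
      rw [norm_mul, Real.norm_eq_abs, Real.norm_eq_abs]
      refine mul_le_one₀ ?_ (abs_nonneg _) (Real.abs_cos_le_one _)
      rw [abs_le]
      constructor <;> linarith [hp.1, hp.2]
    exact Integrable.of_bound (C := 1) (Measurable.aestronglyMeasurable (by fun_prop)) hb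
  have hswap : ∫ ω, (∫ t in (0 : ℝ)..1, (1 - t) * Real.cos (t * (Y ω / ρ))) ∂P =
      ∫ t in (0 : ℝ)..1, ∫ ω, (1 - t) * Real.cos (t * (Y ω / ρ)) ∂P :=
    (intervalIntegral_integral_swap hg).symm
  have hint : Integrable (fun ω => ∫ t in (0 : ℝ)..1, (1 - t) * Real.cos (t * (Y ω / ρ))) P := by
    rw [Set.uIoc_of_le zero_le_one] at hg
    simpa only [intervalIntegral.integral_of_le zero_le_one] using hg.integral_prod_right
  have hset : MeasurableSet {ω | |Y ω| ≤ ρ} := measurableSet_le (by fun_prop) measurable_const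
  have h1 : P.real {ω | |Y ω| ≤ ρ} * (1 / 4) ≤
      ∫ ω, (∫ t in (0 : ℝ)..1, (1 - t) * Real.cos (t * (Y ω / ρ))) ∂P := by
    rw [← smul_eq_mul, ← integral_indicator_const _ hset]
    refine integral_mono ((integrable_const _).indicator hset) hint fun ω => ?_
    by_cases hω : ω ∈ {ω | |Y ω| ≤ ρ}
    · rw [Set.indicator_of_mem hω]
      refine quarter_le_integral_one_sub_mul_cos ?_
      rw [abs_div, abs_of_pos hρ]
      exact div_le_one_of_le₀ hω hρ.le
    · rw [Set.indicator_of_notMem hω]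
      exact integral_one_sub_mul_cos_nonneg _
  have h2 : ∫ t in (0 : ℝ)..1, ∫ ω, (1 - t) * Real.cos (t * (Y ω / ρ)) ∂P ≤
      ∫ t in (0 : ℝ)..1, ‖charFun (P.map Y) (t / ρ)‖ := by
    refine integral_mono_on zero_le_one ?_ ?_ fun t ht => ?_
    · rw [intervalIntegrable_iff]
      exact hg.integral_prod_left
    · have := Measure.isProbabilityMeasure_map (μ := P) hY.aemeasurable
      exact intervalIntegrable_norm_charFun_div _ ρ
    · have h3 := integral_cos_le_norm_charFun (P := P) hY (t / ρ)
      have h4 : ∀ ω, Real.cos (t * (Y ω / ρ)) = Real.cos (t / ρ * Y ω) := fun ω => by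
        congr 1; ring
      simp_rw [MeasureTheory.integral_const_mul, h4]
      calc (1 - t) * ∫ ω, Real.cos (t / ρ * Y ω) ∂P
          ≤ (1 - t) * ‖charFun (P.map Y) (t / ρ)‖ :=
            mul_le_mul_of_nonneg_left h3 (by linarith [ht.2])
        _ ≤ 1 * ‖charFun (P.map Y) (t / ρ)‖ :=
            mul_le_mul_of_nonneg_right (by linarith [ht.1]) (norm_nonneg _)
        _ = _ := one_mul _
  linarith [hswap]

lemma exists_norm_charFun_le_exp {P : Measure Ω} [IsProbabilityMeasure P] {Y : Ω → ℝ}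
    (hY : Measurable Y) (h0 : P[Y] = 0) (h1 : P[Y ^ 2] = 1) :
    ∃ δ > 0, ∀ t : ℝ, |t| ≤ δ → ‖charFun (P.map Y) t‖ ≤ Real.exp (-(t ^ 2 / 4)) := by
  have h := (taylor_charFun_two hY.aemeasurable h0 h1).def (c := 1 / 4) (by norm_num)
  obtain ⟨ε, hε, hball⟩ := Metric.eventually_nhds_iff.1 h
  refine ⟨min (ε / 2) 1, lt_min (by linarith) one_pos, fun t ht => ?_⟩
  have ht1 : |t| ≤ 1 := ht.trans (min_le_right _ _)
  have ht2 : |t| < ε := by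
    have := ht.trans (min_le_left _ _)
    linarith
  have hb := hball (y := t) (by simpa [Real.dist_eq] using ht2)
  have hsq : t ^ 2 ≤ 1 := by rwa [sq_le_one_iff_abs_le_one]
  have hn : ‖(1 - t ^ 2 / 2 : ℂ)‖ = 1 - t ^ 2 / 2 := by
    rw [show (1 - t ^ 2 / 2 : ℂ) = ((1 - t ^ 2 / 2 : ℝ) : ℂ) by push_cast; ring,
      Complex.norm_real, Real.norm_eq_abs, abs_of_nonneg (by linarith)]
  have htri := norm_add_le (charFun (P.map Y) t - (1 - t ^ 2 / 2)) (1 - t ^ 2 / 2 : ℂ)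
  rw [sub_add_cancel, hn] at htri
  rw [Real.norm_eq_abs, abs_of_nonneg (sq_nonneg t)] at hb
  have := Real.add_one_le_exp (-(t ^ 2 / 4))
  linarith

/-- An increment of the walk over `m` steps has absolute value at most `ρ` with probability at most of
order `ρ / √m`. The restriction `1 ≤ ρ` is needed: a lattice walk returns exactly to its starting
point with probability of order `1 / √m`. -/
lemma exists_concentration {P : Measure Ω} [IsProbabilityMeasure P] {X : ℕ → Ω → ℝ}
    (hmeas : ∀ i, Measurable (X i)) (hindep : iIndepFun X P)
    (hident : ∀ i, IdentDistrib (X i) (X 0) P P)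
    (h0 : P[X 0] = 0) (h1 : P[X 0 ^ 2] = 1) :
    ∃ C > 0, ∀ s e : ℕ, s < e → ∀ ρ : ℝ, 1 ≤ ρ →
      P.real {ω | |randomWalk X e ω - randomWalk X s ω| ≤ ρ} ≤ C * ρ / √(e - s : ℝ) := by
  obtain ⟨δ, hδ, hchar⟩ := exists_norm_charFun_le_exp (hmeas 0) h0 h1
  -- Enlarging the window from `ρ` to `c * ρ` keeps the frequencies in the range of `hchar`.
  set c : ℝ := max 1 (1 / δ) with hc
  have hc1 : 1 ≤ c := le_max_left _ _
  refine ⟨4 * √(4 * Real.pi) * c, by positivity, fun s e hse ρ hρ => ?_⟩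
  have hm : (0 : ℝ) < e - s := sub_pos.2 (Nat.cast_lt.2 hse)
  have hcρ : 0 < c * ρ := by positivity
  have hmeasY : Measurable fun ω => ∑ i ∈ Finset.Ico s e, X i ω :=
    Finset.measurable_fun_sum _ fun i _ => hmeas i
  have hφ : ∀ t, charFun (P.map fun ω => ∑ i ∈ Finset.Ico s e, X i ω) t =
      charFun (P.map (X 0)) t ^ (e - s) := by
    intro t
    rw [(hindep.restrict _).charFun_map_fun_finsetSum_eq_prod (fun i _ => (hmeas i).aemeasurable)]
    simp [fun i => (hident i).map_eq]
  have hpt : ∀ t ∈ Set.Icc (0 : ℝ) 1,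
      ‖charFun (P.map fun ω => ∑ i ∈ Finset.Ico s e, X i ω) (t / (c * ρ))‖ ≤
      Real.exp (-((e - s : ℝ) / (4 * (c * ρ) ^ 2)) * t ^ 2) := by
    intro t ht
    have habs : |t / (c * ρ)| ≤ δ := by
      rw [abs_div, abs_of_nonneg ht.1, abs_of_pos hcρ, div_le_iff₀ hcρ]
      have h2 : 1 ≤ δ * c := by
        calc 1 = δ * (1 / δ) := by field_simp
          _ ≤ δ * c := mul_le_mul_of_nonneg_left (le_max_right _ _) hδ.le
      nlinarith [ht.2]
    rw [hφ, norm_pow]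
    refine (pow_le_pow_left₀ (norm_nonneg _) (hchar _ habs) _).trans (le_of_eq ?_)
    rw [← Real.exp_nat_mul, Nat.cast_sub hse.le]
    congr 1
    field_simp
  calc P.real {ω | |randomWalk X e ω - randomWalk X s ω| ≤ ρ}
      ≤ P.real {ω | |∑ i ∈ Finset.Ico s e, X i ω| ≤ c * ρ} := by
        refine measureReal_mono fun ω hω => ?_
        have h2 : |randomWalk X e ω - randomWalk X s ω| ≤ ρ := hω
        rw [randomWalk_sub X hse.le] at h2
        refine h2.trans ?_
        nlinarith
    _ ≤ 4 * ∫ t in (0 : ℝ)..1,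
          ‖charFun (P.map fun ω => ∑ i ∈ Finset.Ico s e, X i ω) (t / (c * ρ))‖ :=
        measureReal_abs_le_le_integral_charFun hmeasY hcρ
    _ ≤ 4 * ∫ t in (0 : ℝ)..1, Real.exp (-((e - s : ℝ) / (4 * (c * ρ) ^ 2)) * t ^ 2) := by
        refine mul_le_mul_of_nonneg_left ?_ (by norm_num)
        have := Measure.isProbabilityMeasure_map (μ := P) hmeasY.aemeasurable
        exact integral_mono_on zero_le_one (intervalIntegrable_norm_charFun_div _ _)
          (Continuous.intervalIntegrable (by fun_prop) _ _) hpt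
    _ ≤ 4 * ∫ t : ℝ, Real.exp (-((e - s : ℝ) / (4 * (c * ρ) ^ 2)) * t ^ 2) := by
        refine mul_le_mul_of_nonneg_left ?_ (by norm_num)
        rw [intervalIntegral.integral_of_le zero_le_one]
        exact setIntegral_le_integral (integrable_exp_neg_mul_sq (by positivity))
          (Filter.Eventually.of_forall fun t => (Real.exp_pos _).le)
    _ = 4 * √(4 * Real.pi) * c * ρ / √(e - s : ℝ) := by
        rw [integral_gaussian,
          show Real.pi / ((e - s : ℝ) / (4 * (c * ρ) ^ 2)) =
            (4 * Real.pi) * (c * ρ) ^ 2 / (e - s : ℝ) by field_simp,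
          Real.sqrt_div (by positivity), Real.sqrt_mul (by positivity), Real.sqrt_sq hcρ.le]
        ring

end Concentration

/-! ### Time blocks visited by a spatial window -/

section Visits

/-- The time axis is cut into blocks `[i * w, (i + 1) * w)`. Among the `K` blocks starting with the
one that contains `s`, these are the (indices of) blocks containing a time `t ∈ [s, N)` at which
`S` is within distance `ρ` of `S s`. -/
noncomputable def visitedBlocks (S : ℕ → ℝ) (w K s N : ℕ) (ρ : ℝ) : Finset ℕ :=
  open Classical in
  (Finset.Ico (s / w) (s / w + K)).filter
    (fun i => ∃ t ∈ Finset.Ico s N, t / w = i ∧ |S t - S s| ≤ ρ)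

lemma mem_visitedBlocks {S : ℕ → ℝ} {w K s N : ℕ} {ρ : ℝ} {i : ℕ} :
    i ∈ visitedBlocks S w K s N ρ ↔ (s / w ≤ i ∧ i < s / w + K) ∧
      ∃ t, (s ≤ t ∧ t < N) ∧ t / w = i ∧ |S t - S s| ≤ ρ := by
  classical
  simp [visitedBlocks]

lemma measurableSet_le_card_filter {Ω ι : Type*} {m : MeasurableSpace Ω} (I : Finset ι)
    {p : ι → Ω → Prop} [∀ ω, DecidablePred fun i => p i ω]
    (hp : ∀ i ∈ I, MeasurableSet[m] {ω | p i ω}) (c : ℕ) :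
    MeasurableSet[m] {ω | c ≤ (I.filter (fun i => p i ω)).card} := by
  classical
  simp_rw [Finset.card_filter]
  refine @measurableSet_le _ _ _ _ _ m _ _ _ _ _ (@measurable_const _ _ _ m _) ?_
  refine @Finset.measurable_fun_sum _ _ _ _ _ _ m _ _ fun i hi => ?_
  exact Measurable.ite (hp i hi) (@measurable_const _ _ _ m _) (@measurable_const _ _ _ m _)

lemma measurableSet_le_card_visitedBlocks {Ω : Type*} {m : MeasurableSpace Ω} {S : ℕ → Ω → ℝ}
    {w K s N : ℕ} {ρ : ℝ} (h : ∀ t, s ≤ t → t < N → Measurable[m] fun ω => S t ω - S s ω) (c : ℕ) :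
    MeasurableSet[m] {ω | c ≤ (visitedBlocks (fun j => S j ω) w K s N ρ).card} := by
  classical
  unfold visitedBlocks
  refine measurableSet_le_card_filter _ (fun i _ => ?_) c
  have heq : {ω | ∃ t ∈ Finset.Ico s N, t / w = i ∧ |S t ω - S s ω| ≤ ρ} =
      ⋃ t ∈ (Finset.Ico s N).filter (fun t => t / w = i), {ω | |S t ω - S s ω| ≤ ρ} := by
    ext ω
    simp [and_assoc]
  rw [heq]
  refine Finset.measurableSet_biUnion _ fun t ht => ?_
  obtain ⟨ht1, ht2⟩ := Finset.mem_Ico.1 (Finset.mem_filter.1 ht).1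
  exact @measurableSet_le _ _ _ _ _ m _ _ _ _ _
    (Measurable.comp (g := fun x : ℝ => |x|) (by fun_prop) (h t ht1 ht2)) (@measurable_const _ _ _ m _)

variable {Ω : Type*} [MeasurableSpace Ω]

/-- Markov's inequality for the number of events that occur. -/
lemma mul_measureReal_le_card_filter_le {ι : Type*} {P : Measure Ω} [IsProbabilityMeasure P]
    (I : Finset ι) {p : ι → Ω → Prop} [∀ ω, DecidablePred fun i => p i ω]
    (hp : ∀ i ∈ I, MeasurableSet {ω | p i ω}) (c : ℕ) :
    c * P.real {ω | c ≤ (I.filter (fun i => p i ω)).card} ≤ ∑ i ∈ I, P.real {ω | p i ω} := by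
  classical
  have hind : ∀ i ∈ I, Integrable ({ω | p i ω}.indicator fun _ => (1 : ℝ)) P := fun i hi =>
    (integrable_const _).indicator (hp i hi)
  have hcard : ∀ ω, ((I.filter (fun i => p i ω)).card : ℝ) =
      ∑ i ∈ I, {ω | p i ω}.indicator (fun _ => (1 : ℝ)) ω := fun ω => by
    rw [Finset.card_filter]
    push_cast
    refine Finset.sum_congr rfl fun i _ => ?_
    simp [Set.indicator_apply]
  have h := mul_meas_ge_le_integral_of_nonneg (μ := P)
    (f := fun ω => ∑ i ∈ I, {ω | p i ω}.indicator (fun _ => (1 : ℝ)) ω)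
    (Filter.Eventually.of_forall fun ω => Finset.sum_nonneg fun i _ =>
      Set.indicator_nonneg (fun _ _ => zero_le_one) _) (integrable_finsetSum _ hind) c
  rw [integral_finsetSum _ hind] at h
  convert! h using 2
  · congr 1
    ext ω
    simp [← hcard]
  · rename_i i hi
    rw [integral_indicator_const _ (hp i hi)]
    simp

variable {P : Measure Ω} [IsProbabilityMeasure P] {X : ℕ → Ω → ℝ}

lemma measureReal_le_abs_randomWalk_sub (hindep : iIndepFun X P)
    (hident : ∀ i, IdentDistrib (X i) (X 0) P P)
    (hL2 : MemLp (X 0) 2 P) (hmean : ∫ ω, X 0 ω ∂P = 0) (hvar : variance (X 0) P = 1)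
    {s e : ℕ} (hse : s ≤ e) {c : ℝ} (hc : 0 < c) :
    P.real {ω | c ≤ |randomWalk X e ω - randomWalk X s ω|} ≤ (e - s : ℝ) / c ^ 2 := by
  have hLp : ∀ i, MemLp (X i) 2 P := fun i => (hident i).memLp_iff.2 hL2
  have hsum : MemLp (∑ i ∈ Finset.Ico s e, X i) 2 P := memLp_finsetSum' _ fun i _ => hLp i
  have hE : P[∑ i ∈ Finset.Ico s e, X i] = 0 := by
    simp_rw [Finset.sum_apply]
    rw [integral_finsetSum _ fun i _ => (hLp i).integrable one_le_two]
    exact Finset.sum_eq_zero fun i _ => (hident i).integral_eq.trans hmean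
  have hV : variance (∑ i ∈ Finset.Ico s e, X i) P = (e - s : ℝ) := by
    rw [IndepFun.variance_sum (fun i _ => hLp i) fun i _ j _ hij => hindep.indepFun hij]
    simp [fun i => (hident i).variance_eq, hvar, Nat.cast_sub hse]
  have h := meas_ge_le_variance_div_sq hsum hc
  rw [hE, hV] at h
  rw [measureReal_def]
  refine ENNReal.toReal_le_of_le_ofReal ?_ ?_
  · exact div_nonneg (sub_nonneg.2 (Nat.cast_le.2 hse)) (sq_nonneg c)
  · convert! h using 3 with ω
    simp [randomWalk_sub X hse]

lemma sum_range_one_div_sqrt_le (K : ℕ) :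
    ∑ d ∈ Finset.range (K + 1), 1 / √(d : ℝ) ≤ 2 * √(K : ℝ) := by
  induction K with
  | zero => simp
  | succ K ih =>
    rw [Finset.sum_range_succ]
    have h1 : (0 : ℝ) ≤ √(K : ℝ) := Real.sqrt_nonneg _
    have h2 : (0 : ℝ) < √((K + 1 : ℕ) : ℝ) := Real.sqrt_pos.2 (by positivity)
    have h3 : √(K : ℝ) ^ 2 = K := Real.sq_sqrt (by positivity)
    have h4 : √((K + 1 : ℕ) : ℝ) ^ 2 = K + 1 := by
      rw [Real.sq_sqrt (by positivity)]
      push_cast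
      ring
    have h5 : 1 / √((K + 1 : ℕ) : ℝ) ≤ 2 * √((K + 1 : ℕ) : ℝ) - 2 * √(K : ℝ) := by
      rw [div_le_iff₀ h2]
      nlinarith [sq_nonneg (√((K + 1 : ℕ) : ℝ) - √(K : ℝ))]
    linarith

/-- Once the walk is in the window at some time of block `i`, it is still nearby at the end of the
block with probability at least `3 / 4`. -/
lemma measureReal_exists_visit_le (hmeas : ∀ i, Measurable (X i)) (hindep : iIndepFun X P)
    (hident : ∀ i, IdentDistrib (X i) (X 0) P P)
    (hL2 : MemLp (X 0) 2 P) (hmean : ∫ ω, X 0 ω ∂P = 0) (hvar : variance (X 0) P = 1)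
    (j s N i : ℕ) :
    P.real {ω | ∃ t ∈ Finset.Ico s N, t / 4 ^ j = i ∧
        |randomWalk X t ω - randomWalk X s ω| ≤ 2 * 2 ^ j} ≤
      4 / 3 * P.real {ω | |randomWalk X ((i + 1) * 4 ^ j) ω - randomWalk X s ω| ≤ 4 * 2 ^ j} := by
  have hw : 0 < 4 ^ j := by positivity
  set e := (i + 1) * 4 ^ j with he
  set V := {ω | ∃ t ∈ Finset.Ico s N, t / 4 ^ j = i ∧
        |randomWalk X t ω - randomWalk X s ω| ≤ 2 * 2 ^ j} with hV
  have hlt : ∀ t, t / 4 ^ j = i → t < e := fun t ht => by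
    rw [he, ← Nat.div_lt_iff_lt_mul hw]
    omega
  have hge : ∀ t, t / 4 ^ j = i → e ≤ t + 4 ^ j := fun t ht => by
    rw [he, add_mul, one_mul, ← ht]
    exact Nat.add_le_add_right (Nat.div_mul_le_self _ _) _
  have hG : P.real (V ∩ {ω | ¬ |randomWalk X e ω - randomWalk X s ω| ≤ 4 * 2 ^ j}) ≤
      1 / 4 * P.real V := by
    refine measureReal_le_of_first_passage hmeas hindep (by norm_num) (N := N)
      (E := fun t => {ω | (s ≤ t ∧ t / 4 ^ j = i) ∧
        |randomWalk X t ω - randomWalk X s ω| ≤ 2 * 2 ^ j})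
      (F := fun t => {ω | t / 4 ^ j = i ∧ 2 * 2 ^ j ≤ |randomWalk X e ω - randomWalk X t ω|})
      ?_ ?_ ?_ ?_ ?_ ?_
    · intro t _
      by_cases h : s ≤ t ∧ t / 4 ^ j = i
      · simp only [h, and_self, true_and]
        have h1 : Measurable[past X t] fun ω => randomWalk X t ω - randomWalk X s ω :=
          (measurable_past_randomWalk X le_rfl).sub (measurable_past_randomWalk X h.1)
        exact @measurableSet_le _ _ _ _ _ (past X t) _ _ _ _ _
          (Measurable.comp (g := fun x : ℝ => |x|) (by fun_prop) h1)
          (@measurable_const _ _ _ (past X t) _)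
      · simp only [h, false_and]
        exact @MeasurableSet.empty _ (past X t)
    · intro t _
      by_cases h : t / 4 ^ j = i
      · simp only [h, true_and]
        exact @measurableSet_le _ _ _ _ _ (future X t) _ _ _ _ _
          (@measurable_const _ _ _ (future X t) _)
          (Measurable.comp (g := fun x : ℝ => |x|) (by fun_prop)
            (measurable_future_randomWalk_sub X (hlt t h).le))
      · simp only [h, false_and]
        exact @MeasurableSet.empty _ (future X t)
    · intro t _
      by_cases h : t / 4 ^ j = i
      · simp only [h, true_and]
        refine (measureReal_le_abs_randomWalk_sub hindep hident hL2 hmean hvar (hlt t h).le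
          (by positivity)).trans ?_
        have h1 : (e : ℝ) ≤ t + 4 ^ j := by exact_mod_cast hge t h
        have h2 : ((2 : ℝ) * 2 ^ j) ^ 2 = 4 * 4 ^ j := by
          rw [mul_pow, ← pow_mul, mul_comm j 2, pow_mul]
          norm_num
        rw [h2, div_le_iff₀ (by positivity)]
        linarith
      · simp [h]
    · rintro t ht ω ⟨⟨h1, h2⟩, h3⟩
      exact ⟨t, Finset.mem_Ico.2 ⟨h1, ht⟩, h2, h3⟩
    · rintro ω ⟨⟨t, ht, h2, h3⟩, -⟩
      exact ⟨t, (Finset.mem_Ico.1 ht).2, ⟨(Finset.mem_Ico.1 ht).1, h2⟩, h3⟩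
    · rintro ω ⟨-, hω⟩ t _ ⟨⟨_, h2⟩, h3⟩ _
      refine ⟨h2, ?_⟩
      have h4 : ¬ |randomWalk X e ω - randomWalk X s ω| ≤ 4 * 2 ^ j := hω
      have h5 := abs_sub_le (randomWalk X e ω) (randomWalk X t ω) (randomWalk X s ω)
      linarith
  have hsplit : P.real V ≤ P.real {ω | |randomWalk X e ω - randomWalk X s ω| ≤ 4 * 2 ^ j} +
      P.real (V ∩ {ω | ¬ |randomWalk X e ω - randomWalk X s ω| ≤ 4 * 2 ^ j}) := by
    refine (measureReal_mono ?_ (measure_ne_top _ _)).trans (measureReal_union_le _ _)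
    intro ω hω
    by_cases h : |randomWalk X e ω - randomWalk X s ω| ≤ 4 * 2 ^ j
    · exact Or.inl h
    · exact Or.inr ⟨hω, h⟩
  linarith

/-- At time scale `4 ^ j` and space scale `2 ^ j`, a window is visited in the order of `2 ^ k` of
`4 ^ k` consecutive blocks, with probability at least `1 / 2`. -/
lemma exists_measureReal_card_visitedBlocks_le_half
    (hmeas : ∀ i, Measurable (X i)) (hindep : iIndepFun X P)
    (hident : ∀ i, IdentDistrib (X i) (X 0) P P)
    (hL2 : MemLp (X 0) 2 P) (hmean : ∫ ω, X 0 ω ∂P = 0) (hvar : variance (X 0) P = 1) :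
    ∃ C : ℕ, 0 < C ∧ ∀ j k s N : ℕ,
      P.real {ω | C * 2 ^ k + 1 ≤
        (visitedBlocks (fun t => randomWalk X t ω) (4 ^ j) (4 ^ k) s N (2 * 2 ^ j)).card} ≤
        1 / 2 := by
  classical
  have hsq : P[X 0 ^ 2] = 1 := by
    rw [← hvar, variance_of_integral_eq_zero hL2.aemeasurable hmean]
    rfl
  obtain ⟨C, hC, hconc⟩ := exists_concentration hmeas hindep hident hmean hsq
  obtain ⟨D, hD⟩ := exists_nat_ge (1 + 32 / 3 * C)
  have hDpos : (0 : ℝ) < D := by nlinarith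
  refine ⟨2 * D, by have := Nat.cast_pos.1 hDpos; omega, fun j k s N => ?_⟩
  have hw : 0 < 4 ^ j := by positivity
  have hpow : ∀ a : ℕ, √((4 : ℝ) ^ a) = 2 ^ a := fun a => by
    rw [show (4 : ℝ) = 2 ^ 2 by norm_num, ← pow_mul, mul_comm, pow_mul]
    exact Real.sqrt_sq (by positivity)
  set p : ℕ → Ω → Prop := fun i ω => ∃ t ∈ Finset.Ico s N, t / 4 ^ j = i ∧
        |randomWalk X t ω - randomWalk X s ω| ≤ 2 * 2 ^ j with hp
  have hpm : ∀ i, MeasurableSet {ω | p i ω} := fun i => by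
    have heq : {ω | p i ω} = ⋃ t ∈ (Finset.Ico s N).filter (fun t => t / 4 ^ j = i),
        {ω | |randomWalk X t ω - randomWalk X s ω| ≤ 2 * 2 ^ j} := by
      ext ω
      simp [hp, and_assoc]
    rw [heq]
    refine Finset.measurableSet_biUnion _ fun t _ => measurableSet_le ?_ measurable_const
    have h1 := measurable_randomWalk hmeas t
    have h2 := measurable_randomWalk hmeas s
    fun_prop
  have hmarkov := mul_measureReal_le_card_filter_le (P := P)
    (Finset.Ico (s / 4 ^ j) (s / 4 ^ j + 4 ^ k)) (fun i _ => hpm i) (2 * D * 2 ^ k + 1)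
  have hterm : ∀ d ∈ Finset.range (4 ^ k), P.real {ω | p (s / 4 ^ j + d) ω} ≤
      (if d = 0 then 1 else 0) + 16 / 3 * C * (1 / √(d : ℝ)) := by
    intro d _
    rcases Nat.eq_zero_or_pos d with rfl | hd
    · simp
    · rw [if_neg hd.ne', zero_add]
      refine (measureReal_exists_visit_le hmeas hindep hident hL2 hmean hvar j s N _).trans ?_
      have hse : s + d * 4 ^ j ≤ (s / 4 ^ j + d + 1) * 4 ^ j := by
        have := Nat.lt_div_mul_add (a := s) hw
        nlinarith
      have hse' : s < (s / 4 ^ j + d + 1) * 4 ^ j :=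
        lt_of_lt_of_le (Nat.lt_add_of_pos_right (by positivity)) hse
      have h1 := hconc s _ hse' (4 * 2 ^ j) (by nlinarith [one_le_pow₀ (M₀ := ℝ) one_le_two (n := j)])
      have h2 : √(d : ℝ) * 2 ^ j ≤ √((((s / 4 ^ j + d + 1) * 4 ^ j : ℕ) : ℝ) - s) := by
        rw [← hpow j, ← Real.sqrt_mul (by positivity)]
        refine Real.sqrt_le_sqrt ?_
        have : ((s + d * 4 ^ j : ℕ) : ℝ) ≤ (((s / 4 ^ j + d + 1) * 4 ^ j : ℕ) : ℝ) :=
          Nat.cast_le.2 hse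
        push_cast at this ⊢
        linarith
      have hd' : 0 < √(d : ℝ) := Real.sqrt_pos.2 (Nat.cast_pos.2 hd)
      calc _ ≤ 4 / 3 * (C * (4 * 2 ^ j) / (√(d : ℝ) * 2 ^ j)) := by
            refine mul_le_mul_of_nonneg_left (h1.trans ?_) (by norm_num)
            exact div_le_div_of_nonneg_left (by positivity) (by positivity) h2
        _ = 16 / 3 * C * (1 / √(d : ℝ)) := by
            field_simp
            ring
  have hsum : ∑ i ∈ Finset.Ico (s / 4 ^ j) (s / 4 ^ j + 4 ^ k), P.real {ω | p i ω} ≤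
      D * 2 ^ k := by
    rw [Finset.sum_Ico_eq_sum_range, Nat.add_sub_cancel_left]
    refine (Finset.sum_le_sum hterm).trans ?_
    rw [Finset.sum_add_distrib, ← Finset.mul_sum, Finset.sum_ite_eq']
    have h1 : ∑ d ∈ Finset.range (4 ^ k), 1 / √(d : ℝ) ≤ 2 * 2 ^ k := by
      have h2 := sum_range_one_div_sqrt_le (4 ^ k)
      push_cast at h2
      rw [hpow, Finset.sum_range_succ] at h2
      have h3 : 0 ≤ 1 / √((4 ^ k : ℕ) : ℝ) := by positivity
      linarith
    have h4 : (if 0 ∈ Finset.range (4 ^ k) then (1 : ℝ) else 0) ≤ 1 := by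
      split_ifs <;> norm_num
    have h5 : (1 : ℝ) ≤ 2 ^ k := one_le_pow₀ one_le_two
    have h6 := mul_le_mul_of_nonneg_left h1 (show (0 : ℝ) ≤ 16 / 3 * C by positivity)
    nlinarith
  have hfin := hmarkov.trans hsum
  have hset : {ω | 2 * D * 2 ^ k + 1 ≤
        (visitedBlocks (fun t => randomWalk X t ω) (4 ^ j) (4 ^ k) s N (2 * 2 ^ j)).card} =
      {ω | 2 * D * 2 ^ k + 1 ≤ ((Finset.Ico (s / 4 ^ j) (s / 4 ^ j + 4 ^ k)).filter
        (fun i => p i ω)).card} := by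
    ext ω
    simp only [visitedBlocks, hp, Set.mem_ofPred_eq]
  rw [hset]
  push_cast at hfin
  have h7 : (0 : ℝ) < D * 2 ^ k := by positivity
  by_contra hcon
  push Not at hcon
  nlinarith

lemma card_visitedBlocks_le_add {S : ℕ → ℝ} {w K s t N : ℕ} {h : ℝ} (hst : s ≤ t)
    (ht : |S t - S s| ≤ h) :
    (visitedBlocks S w K s N h).card ≤ (visitedBlocks S w K s t h).card +
      (visitedBlocks S w K t N (2 * h)).card := by
  classical
  refine (Finset.card_le_card ?_).trans (Finset.card_union_le _ _)
  intro i hi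
  obtain ⟨⟨hi1, hi2⟩, u, ⟨hu1, hu2⟩, hu3, hu4⟩ := mem_visitedBlocks.1 hi
  rw [Finset.mem_union]
  rcases lt_or_ge u t with hut | hut
  · exact Or.inl (mem_visitedBlocks.2 ⟨⟨hi1, hi2⟩, u, ⟨hu1, hut⟩, hu3, hu4⟩)
  · refine Or.inr (mem_visitedBlocks.2 ⟨⟨?_, ?_⟩, u, ⟨hut, hu2⟩, hu3, ?_⟩)
    · exact hu3 ▸ Nat.div_le_div_right hut
    · exact hi2.trans_le (Nat.add_le_add_right (Nat.div_le_div_right hst) _)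
    · have h1 := abs_sub_le (S u) (S s) (S t)
      rw [abs_sub_comm (S s)] at h1
      linarith

lemma visitedBlocks_eq_empty {S : ℕ → ℝ} {w K s N : ℕ} {h : ℝ} (hN : N ≤ s) :
    visitedBlocks S w K s N h = ∅ := by
  refine Finset.eq_empty_of_forall_notMem fun i hi => ?_
  obtain ⟨-, u, ⟨hu1, hu2⟩, -⟩ := mem_visitedBlocks.1 hi
  omega

lemma visitedBlocks_succ_of_lt_abs {S : ℕ → ℝ} {w K s t : ℕ} {h : ℝ} (ht : h < |S t - S s|) :
    visitedBlocks S w K s (t + 1) h ⊆ visitedBlocks S w K s t h := by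
  intro i hi
  obtain ⟨hi1, u, ⟨hu1, hu2⟩, hu3, hu4⟩ := mem_visitedBlocks.1 hi
  refine mem_visitedBlocks.2 ⟨hi1, u, ⟨hu1, ?_⟩, hu3, hu4⟩
  rcases Nat.lt_succ_iff_lt_or_eq.1 hu2 with h1 | rfl
  · exact h1
  · exact absurd hu4 (not_le.2 ht)

/-- Restarting the walk each time `m` new blocks have been visited turns a bound of `1 / 2` for a
window of twice the size into a geometric tail. -/
lemma measureReal_card_visitedBlocks_le_pow
    (hmeas : ∀ i, Measurable (X i)) (hindep : iIndepFun X P) {w K m N : ℕ} {h : ℝ}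
    (hhalf : ∀ t, P.real {ω | m + 1 ≤
        (visitedBlocks (fun t => randomWalk X t ω) w K t N (2 * h)).card} ≤ 1 / 2) (s r : ℕ) :
    P.real {ω | r * m + 1 ≤ (visitedBlocks (fun t => randomWalk X t ω) w K s N h).card} ≤
      (1 / 2) ^ r := by
  induction r with
  | zero => simp
  | succ r ih =>
    rw [pow_succ']
    refine le_trans ?_ (mul_le_mul_of_nonneg_left ih (by norm_num))
    refine measureReal_le_of_first_passage hmeas hindep (by norm_num) (N := N)
      (E := fun t => {ω | r * m + 1 ≤
        (visitedBlocks (fun t => randomWalk X t ω) w K s (t + 1) h).card})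
      (F := fun t => {ω | m + 1 ≤
        (visitedBlocks (fun t => randomWalk X t ω) w K t N (2 * h)).card})
      ?_ ?_ ?_ ?_ ?_ ?_
    · intro t _
      refine measurableSet_le_card_visitedBlocks (fun u hu1 hu2 => ?_) _
      exact (measurable_past_randomWalk X (Nat.lt_succ_iff.1 hu2)).sub
        (measurable_past_randomWalk X (hu1.trans (Nat.lt_succ_iff.1 hu2)))
    · intro t _
      exact measurableSet_le_card_visitedBlocks
        (fun u hu _ => measurable_future_randomWalk_sub X hu) _
    · exact fun t _ => hhalf t
    · intro t ht ω hω
      refine le_trans (show r * m + 1 ≤ _ from hω) (Finset.card_le_card fun i hi => ?_)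
      obtain ⟨hi1, u, ⟨hu1, hu2⟩, hu3⟩ := mem_visitedBlocks.1 hi
      exact mem_visitedBlocks.2 ⟨hi1, u, ⟨hu1, by omega⟩, hu3⟩
    · intro ω hω
      have hω' : (r + 1) * m + 1 ≤
        (visitedBlocks (fun t => randomWalk X t ω) w K s N h).card := hω
      have hN : 0 < N := by
        by_contra hN
        rw [visitedBlocks_eq_empty (by omega)] at hω'
        simp at hω'
      refine ⟨N - 1, by omega, ?_⟩
      show r * m + 1 ≤ _
      rw [Nat.sub_add_cancel hN]
      nlinarith
    · intro ω hω t ht hEt hmin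
      have hω' : (r + 1) * m + 1 ≤
        (visitedBlocks (fun t => randomWalk X t ω) w K s N h).card := hω
      have hEt' : r * m + 1 ≤
        (visitedBlocks (fun t => randomWalk X t ω) w K s (t + 1) h).card := hEt
      have hst : s ≤ t := by
        by_contra hst
        rw [visitedBlocks_eq_empty (by omega)] at hEt'
        simp at hEt'
      have hbefore : (visitedBlocks (fun t => randomWalk X t ω) w K s t h).card ≤ r * m := by
        rcases Nat.eq_zero_or_pos t with rfl | htp
        · rw [visitedBlocks_eq_empty (by omega)]
          simp
        · have h1 : ¬ r * m + 1 ≤ _ := hmin (t - 1) (by omega)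
          rw [Nat.sub_add_cancel htp] at h1
          omega
      have hvisit : |randomWalk X t ω - randomWalk X s ω| ≤ h := by
        by_contra hcon
        have := Finset.card_le_card (visitedBlocks_succ_of_lt_abs (w := w) (K := K)
          (S := fun t => randomWalk X t ω) (not_le.1 hcon))
        omega
      have h2 := card_visitedBlocks_le_add (S := fun t => randomWalk X t ω) (w := w) (K := K)
        (N := N) hst hvisit
      show m + 1 ≤ _
      have h3 : (r + 1) * m = r * m + m := by ring
      omega

end Visits

/-! ### Paths with few visited blocks have short increasing subsequences -/

section Deterministic

/-- The number of blocks `[i * w, (i + 1) * w)` met by a set of times. -/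
def blockCount (A : Finset ℕ) (w : ℕ) : ℕ := (A.image (fun t => t / w)).card

lemma blockCount_one (A : Finset ℕ) : blockCount A 1 = A.card := by
  simp [blockCount]

lemma blockCount_le_mul (A : Finset ℕ) (w K : ℕ) (hK : 0 < K) :
    blockCount A w ≤ K * blockCount A (w * K) := by
  classical
  unfold blockCount
  refine Finset.card_le_mul_card_image_of_maps_to (f := fun i => i / K) ?_ K ?_
  · intro i hi
    obtain ⟨t, ht, rfl⟩ := Finset.mem_image.1 hi
    exact Finset.mem_image.2 ⟨t, ht, (Nat.div_div_eq_div_mul _ _ _).symm⟩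
  · intro b _
    have hsub : (A.image (fun t => t / w)).filter (fun i => i / K = b) ⊆
        Finset.Ico (b * K) (b * K + K) := by
      intro i hi
      obtain ⟨-, rfl⟩ := Finset.mem_filter.1 hi
      exact Finset.mem_Ico.2 ⟨Nat.div_mul_le_self _ _, Nat.lt_div_mul_add hK⟩
    exact (Finset.card_le_card hsub).trans (by simp)

/-- Passing to a scale finer by a factor `K` in time. Over a coarse block on which the monotone
restriction `S|_A` rises by at most `h`, the set `A` meets at most `Λ` fine blocks. The coarse blocks
with a larger rise are at most `2 * B + 1` in number, because the total rise is at most `2 * B * h`;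
these contribute at most `K` fine blocks each. -/
lemma blockCount_le_of_visitedBlocks {S : ℕ → ℝ} {A : Finset ℕ} {w K N Λ B : ℕ} {h : ℝ}
    (hA : A ⊆ Finset.range N) (hS : MonotoneOn S (A : Set ℕ)) (hK : 0 < K) (hh : 0 < h)
    (hrange : ∀ t < N, |S t| ≤ B * h)
    (hvisit : ∀ s < N, (visitedBlocks S w K s N h).card ≤ Λ) :
    blockCount A w ≤ Λ * blockCount A (w * K) + K * (2 * B + 1) := by
  classical
  set U := A.image (fun t => t / w) with hU
  set T := A.image (fun t => t / (w * K)) with hT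
  have hmaps : ∀ i ∈ U, i / K ∈ T := by
    intro i hi
    obtain ⟨t, ht, rfl⟩ := Finset.mem_image.1 hi
    exact Finset.mem_image.2 ⟨t, ht, (Nat.div_div_eq_div_mul _ _ _).symm⟩
  have hfirst : ∀ b ∈ T, ∃ s ∈ A, s / (w * K) = b ∧ ∀ t ∈ A, t / (w * K) = b → s ≤ t := by
    intro b hb
    obtain ⟨t, ht, htb⟩ := Finset.mem_image.1 hb
    have hne : (A.filter (fun t => t / (w * K) = b)).Nonempty :=
      ⟨t, Finset.mem_filter.2 ⟨ht, htb⟩⟩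
    obtain ⟨h1, h2⟩ := Finset.mem_filter.1 (Finset.min'_mem _ hne)
    exact ⟨_, h1, h2, fun t ht htb => Finset.min'_le _ _ (Finset.mem_filter.2 ⟨ht, htb⟩)⟩
  choose! first hfA hfb hfle using hfirst
  -- The coarse blocks over which `S` rises by more than `h` along `A`.
  set L := T.filter (fun b => ∃ t ∈ A, t / (w * K) = b ∧ S (first b) + h < S t) with hL
  have hfiber : ∀ b ∈ T, (U.filter (fun i => i / K = b)).card ≤ Λ + if b ∈ L then K else 0 := by
    intro b hb
    split_ifs with hbL
    · have hsub : U.filter (fun i => i / K = b) ⊆ Finset.Ico (b * K) (b * K + K) := by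
        intro i hi
        obtain ⟨-, rfl⟩ := Finset.mem_filter.1 hi
        exact Finset.mem_Ico.2 ⟨Nat.div_mul_le_self _ _, Nat.lt_div_mul_add hK⟩
      have h1 := Finset.card_le_card hsub
      rw [Nat.card_Ico] at h1
      omega
    · rw [add_zero]
      refine le_trans (Finset.card_le_card fun i hi => ?_)
        (hvisit (first b) (Finset.mem_range.1 (hA (hfA b hb))))
      obtain ⟨hiU, hib⟩ := Finset.mem_filter.1 hi
      obtain ⟨t, ht, hti⟩ := Finset.mem_image.1 hiU
      have htb : t / (w * K) = b := by rw [← Nat.div_div_eq_div_mul, hti, hib]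
      have hle := hfle b hb t ht htb
      have hfK : first b / w / K = b := by rw [Nat.div_div_eq_div_mul, hfb b hb]
      refine mem_visitedBlocks.2 ⟨⟨hti ▸ Nat.div_le_div_right hle, ?_⟩, t,
        ⟨hle, Finset.mem_range.1 (hA ht)⟩, hti, ?_⟩
      · have h1 : i < b * K + K := hib ▸ Nat.lt_div_mul_add hK
        have h2 : b * K ≤ first b / w := by
          have h3 := Nat.div_mul_le_self (first b / w) K
          rwa [hfK] at h3
        omega
      · have h1 : S (first b) ≤ S t := hS (hfA b hb) ht hle
        have h2 : ¬ S (first b) + h < S t := fun h2 =>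
          hbL (Finset.mem_filter.2 ⟨hb, t, ht, htb, h2⟩)
        rw [abs_of_nonneg (sub_nonneg.2 h1)]
        linarith
  -- The values at the first points of two blocks in `L` differ by more than `h`.
  have hgap : ∀ b ∈ L, ∀ b' ∈ L, b < b' → S (first b) + h < S (first b') := by
    intro b hb b' hb' hbb
    obtain ⟨-, t, ht, htb, hrise⟩ := Finset.mem_filter.1 hb
    have hb'T := (Finset.mem_filter.1 hb').1
    have hlt : t < first b' := by
      by_contra hcon
      have h1 : first b' / (w * K) ≤ t / (w * K) := Nat.div_le_div_right (not_lt.1 hcon)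
      rw [hfb b' hb'T, htb] at h1
      omega
    exact hrise.trans_le (hS ht (hfA b' hb'T) hlt.le)
  have hLcard : L.card ≤ 2 * B + 1 := by
    have hinj : Set.InjOn (fun b => ⌊S (first b) / h⌋) (L : Set ℕ) := by
      have hne : ∀ b ∈ L, ∀ b' ∈ L, b < b' → ⌊S (first b) / h⌋ ≠ ⌊S (first b') / h⌋ := by
        intro b hb b' hb' hbb heq
        have h1 := Int.abs_sub_lt_one_of_floor_eq_floor heq
        rw [← sub_div, abs_div, abs_of_pos hh, div_lt_one hh, abs_lt] at h1
        linarith [hgap b hb b' hb' hbb]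
      intro b hb b' hb' heq
      by_contra hcon
      rcases lt_or_gt_of_ne hcon with h1 | h1
      · exact hne b hb b' hb' h1 heq
      · exact hne b' hb' b hb h1 heq.symm
    have hmem : ∀ b ∈ L, ⌊S (first b) / h⌋ ∈ Finset.Icc (-(B : ℤ)) B := by
      intro b hb
      have hbT := (Finset.mem_filter.1 hb).1
      have h1 := abs_le.1 (hrange _ (Finset.mem_range.1 (hA (hfA b hbT))))
      rw [Finset.mem_Icc]
      constructor
      · rw [Int.le_floor, le_div_iff₀ hh]
        push_cast
        linarith [h1.1]
      · have h2 : S (first b) / h ≤ B := by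
          rw [div_le_iff₀ hh]
          exact h1.2
        exact_mod_cast (Int.floor_le _).trans h2
    have h1 := Finset.card_le_card_of_injOn _ hmem hinj
    rw [Int.card_Icc] at h1
    omega
  calc blockCount A w = ∑ b ∈ T, (U.filter (fun i => i / K = b)).card :=
        Finset.card_eq_sum_card_fiberwise hmaps
    _ ≤ ∑ b ∈ T, (Λ + if b ∈ L then K else 0) := Finset.sum_le_sum hfiber
    _ = Λ * T.card + K * L.card := by
        rw [Finset.sum_add_distrib, Finset.sum_const, smul_eq_mul, mul_comm, ← Finset.sum_filter,
          Finset.filter_mem_eq_inter, Finset.inter_eq_right.2 (Finset.filter_subset _ _),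
          Finset.sum_const, smul_eq_mul, mul_comm K]
    _ ≤ Λ * blockCount A (w * K) + K * (2 * B + 1) :=
        Nat.add_le_add_left (Nat.mul_le_mul_left _ hLcard) _

/-- The regularity of a path of length `4 ^ n` that keeps increasing subsequences short: it stays
in an interval of length of order `2 ^ n`, and at every scale `4 ^ j` the window of radius `2 ^ j`
around any of its points is visited in at most `lam * 2 ^ k` of the next `4 ^ k` blocks. -/
structure IsRegularPath (S : ℕ → ℝ) (n k lam : ℕ) : Prop where
  abs_le : ∀ t < 4 ^ n, |S t| ≤ 6 * 2 ^ n
  card_visitedBlocks_le : ∀ j ≤ n, ∀ s < 4 ^ n,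
    (visitedBlocks S (4 ^ j) (4 ^ k) s (4 ^ n) (2 ^ j)).card ≤ lam * 2 ^ k

/-- Iterating the passage from scale `4 ^ (j + k)` to scale `4 ^ j` gives a linear recursion for the
block counts normalised by `2 ^ (n - j)`, with factor `lam`. -/
lemma IsRegularPath.blockCount_add_le {S : ℕ → ℝ} {n k lam : ℕ} (hreg : IsRegularPath S n k lam)
    (hlam : 2 ≤ lam) {A : Finset ℕ} (hA : A ⊆ Finset.range (4 ^ n))
    (hS : MonotoneOn S (A : Set ℕ)) (i : ℕ) (hi : i * k ≤ n) :
    blockCount A (4 ^ (n - i * k)) + 13 * 4 ^ k * 2 ^ (i * k) ≤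
      (lam * 2 ^ k) ^ i * (1 + 13 * 4 ^ k) := by
  classical
  induction i with
  | zero =>
    have h1 : blockCount A (4 ^ n) ≤ 1 := by
      have hsub : A.image (fun t => t / 4 ^ n) ⊆ {0} := by
        intro b hb
        obtain ⟨t, ht, rfl⟩ := Finset.mem_image.1 hb
        simpa using Finset.mem_range.1 (hA ht)
      simpa [blockCount] using Finset.card_le_card hsub
    simpa using h1
  | succ i ih =>
    have hik : (i + 1) * k = i * k + k := by ring
    have ih := ih (by omega)
    set j := n - (i + 1) * k with hj
    have hjk : n - i * k = j + k := by omega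
    have hjn : n = j + (i + 1) * k := by omega
    have hstep := blockCount_le_of_visitedBlocks (B := 6 * 2 ^ ((i + 1) * k)) (h := 2 ^ j)
      (w := 4 ^ j) (K := 4 ^ k) (Λ := lam * 2 ^ k) hA hS (by positivity)
      (by positivity) (fun t ht => (hreg.abs_le t ht).trans (le_of_eq ?_))
      (hreg.card_visitedBlocks_le j (by omega))
    · rw [← pow_add, ← hjk] at hstep
      have hD : 4 ^ k * (2 * (6 * 2 ^ ((i + 1) * k)) + 1) ≤ 13 * 4 ^ k * 2 ^ ((i + 1) * k) := by
        have : 1 ≤ 2 ^ ((i + 1) * k) := Nat.one_le_two_pow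
        nlinarith [show 0 < 4 ^ k by positivity]
      calc blockCount A (4 ^ j) + 13 * 4 ^ k * 2 ^ ((i + 1) * k)
          ≤ lam * 2 ^ k * blockCount A (4 ^ (n - i * k)) + 2 * (13 * 4 ^ k * 2 ^ ((i + 1) * k)) := by
            omega
        _ ≤ lam * 2 ^ k * blockCount A (4 ^ (n - i * k)) +
              lam * (13 * 4 ^ k * 2 ^ ((i + 1) * k)) :=
            Nat.add_le_add_left (Nat.mul_le_mul_right _ hlam) _
        _ = lam * 2 ^ k * (blockCount A (4 ^ (n - i * k)) + 13 * 4 ^ k * 2 ^ (i * k)) := by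
            rw [hik, pow_add]
            ring
        _ ≤ lam * 2 ^ k * ((lam * 2 ^ k) ^ i * (1 + 13 * 4 ^ k)) := Nat.mul_le_mul_left _ ih
        _ = _ := by ring
    · push_cast
      rw [mul_assoc, ← pow_add, add_comm, ← hjn]

lemma IsRegularPath.LIS_le {S : ℕ → ℝ} {n k lam : ℕ} (hreg : IsRegularPath S n k lam)
    (hlam : 2 ≤ lam) (hk : 0 < k) :
    LIS S (Finset.range (4 ^ n)) ≤ 14 * 2 ^ n * 8 ^ k * lam ^ (n / k) := by
  obtain ⟨A, hA, hS, hc⟩ := exists_card_eq_LIS S (Finset.range (4 ^ n))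
  have hq : n / k * k ≤ n := Nat.div_mul_le_self n k
  have h1 := hreg.blockCount_add_le hlam hA hS (n / k) hq
  set r := n - n / k * k with hr
  have hrk : r ≤ k := by
    have := Nat.lt_div_mul_add (a := n) hk
    omega
  have h2 := blockCount_le_mul A 1 (4 ^ r) (by positivity)
  rw [blockCount_one, one_mul] at h2
  have hn : 2 ^ n = 2 ^ (n / k * k) * 2 ^ r := by rw [← pow_add]; congr 1; omega
  calc LIS S (Finset.range (4 ^ n)) = A.card := hc.symm
    _ ≤ 4 ^ r * ((lam * 2 ^ k) ^ (n / k) * (1 + 13 * 4 ^ k)) :=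
        h2.trans (Nat.mul_le_mul_left _ (by omega))
    _ ≤ 4 ^ r * ((lam * 2 ^ k) ^ (n / k) * (14 * 4 ^ k)) := by
        refine Nat.mul_le_mul_left _ (Nat.mul_le_mul_left _ ?_)
        have : 0 < 4 ^ k := by positivity
        omega
    _ = 14 * 2 ^ n * (2 ^ r * 4 ^ k) * lam ^ (n / k) := by
        rw [hn, mul_pow, ← pow_mul, mul_comm k, show 4 ^ r = 2 ^ r * 2 ^ r by
          rw [← mul_pow]; norm_num]
        ring
    _ ≤ 14 * 2 ^ n * (2 ^ k * 4 ^ k) * lam ^ (n / k) := by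
        refine Nat.mul_le_mul_right _ (Nat.mul_le_mul_left _ (Nat.mul_le_mul_right _ ?_))
        exact Nat.pow_le_pow_right (by norm_num) hrk
    _ = 14 * 2 ^ n * 8 ^ k * lam ^ (n / k) := by rw [← mul_pow]; norm_num

end Deterministic

/-! ### Random walk paths are regular -/

section Regular

variable {Ω : Type*} [MeasurableSpace Ω] {P : Measure Ω} [IsProbabilityMeasure P] {X : ℕ → Ω → ℝ}

/-- A maximal inequality of Ottaviani type. -/
lemma measureReal_exists_lt_abs_randomWalk_le
    (hmeas : ∀ i, Measurable (X i)) (hindep : iIndepFun X P)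
    (hident : ∀ i, IdentDistrib (X i) (X 0) P P)
    (hL2 : MemLp (X 0) 2 P) (hmean : ∫ ω, X 0 ω ∂P = 0) (hvar : variance (X 0) P = 1)
    (N : ℕ) {a : ℝ} (ha : 0 < a) :
    P.real {ω | ∃ t < N, 2 * a < |randomWalk X t ω|} ≤ 2 * N / a ^ 2 := by
  set H := {ω | ∃ t < N, 2 * a < |randomWalk X t ω|} with hH
  have hcheb : ∀ t ≤ N, P.real {ω | a ≤ |randomWalk X N ω - randomWalk X t ω|} ≤ N / a ^ 2 := by
    intro t ht
    refine (measureReal_le_abs_randomWalk_sub hindep hident hL2 hmean hvar ht ha).trans ?_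
    gcongr
    simp
  have hG : P.real (H ∩ {ω | ¬ a ≤ |randomWalk X N ω|}) ≤ N / a ^ 2 * P.real H := by
    refine measureReal_le_of_first_passage hmeas hindep (by positivity) (N := N)
      (E := fun t => {ω | 2 * a < |randomWalk X t ω|})
      (F := fun t => {ω | a ≤ |randomWalk X N ω - randomWalk X t ω|}) ?_ ?_ ?_ ?_ ?_ ?_
    · intro t _
      exact @measurableSet_lt _ _ _ _ _ (past X t) _ _ _ _ _
        (@measurable_const _ _ _ (past X t) _)
        (Measurable.comp (g := fun x : ℝ => |x|) (by fun_prop)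
          (measurable_past_randomWalk X le_rfl))
    · intro t ht
      exact @measurableSet_le _ _ _ _ _ (future X t) _ _ _ _ _
        (@measurable_const _ _ _ (future X t) _)
        (Measurable.comp (g := fun x : ℝ => |x|) (by fun_prop)
          (measurable_future_randomWalk_sub X ht.le))
    · exact fun t ht => hcheb t ht.le
    · exact fun t ht ω hω => ⟨t, ht, hω⟩
    · exact fun ω hω => hω.1
    · rintro ω ⟨-, hω⟩ t _ hE _
      have h1 : ¬ a ≤ |randomWalk X N ω| := hω
      have h2 : 2 * a < |randomWalk X t ω| := hE
      have h3 := abs_sub_abs_le_abs_sub (randomWalk X t ω) (randomWalk X N ω)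
      rw [abs_sub_comm] at h3
      show a ≤ _
      linarith
  have h0 : P.real {ω | a ≤ |randomWalk X N ω|} ≤ N / a ^ 2 := by
    have := hcheb 0 (Nat.zero_le _)
    simpa [randomWalk] using this
  have hsplit : P.real H ≤ P.real {ω | a ≤ |randomWalk X N ω|} +
      P.real (H ∩ {ω | ¬ a ≤ |randomWalk X N ω|}) := by
    refine (measureReal_mono ?_ (measure_ne_top _ _)).trans (measureReal_union_le _ _)
    intro ω hω
    by_cases h : a ≤ |randomWalk X N ω|
    · exact Or.inl h
    · exact Or.inr ⟨hω, h⟩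
  have h1 : P.real H ≤ 1 := measureReal_le_one
  have h2 : N / a ^ 2 * P.real H ≤ N / a ^ 2 := mul_le_of_le_one_right (by positivity) h1
  rw [mul_div_assoc]
  linarith

lemma exists_measureReal_not_isRegularPath_le
    (hmeas : ∀ i, Measurable (X i)) (hindep : iIndepFun X P)
    (hident : ∀ i, IdentDistrib (X i) (X 0) P P)
    (hL2 : MemLp (X 0) 2 P) (hmean : ∫ ω, X 0 ω ∂P = 0) (hvar : variance (X 0) P = 1) :
    ∃ C : ℕ, 0 < C ∧ ∀ n k : ℕ, 5 ≤ n →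
      P.real {ω | ¬ IsRegularPath (fun t => randomWalk X t ω) n k (C * n)} ≤ 1 / 2 := by
  obtain ⟨C, hC, hhalf⟩ :=
    exists_measureReal_card_visitedBlocks_le_half hmeas hindep hident hL2 hmean hvar
  -- The tail `2 ^ (-r)` with `r = 3 * n` beats the number `(n + 1) * 4 ^ n` of pairs of a scale and
  -- a starting point.
  refine ⟨3 * C, by omega, fun n k hn => ?_⟩
  set bad : ℕ → ℕ → Set Ω := fun j s => {ω | (3 * n) * (C * 2 ^ k) + 1 ≤
    (visitedBlocks (fun t => randomWalk X t ω) (4 ^ j) (4 ^ k) s (4 ^ n) (2 ^ j)).card} with hbad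
  have hbadle : ∀ j s, P.real (bad j s) ≤ (1 / 2) ^ (3 * n) := fun j s =>
    measureReal_card_visitedBlocks_le_pow hmeas hindep (fun t => hhalf j k t (4 ^ n)) s (3 * n)
  have hrange : P.real {ω | ∃ t < 4 ^ n, 2 * (3 * 2 ^ n) < |randomWalk X t ω|} ≤ 1 / 4 := by
    refine (measureReal_exists_lt_abs_randomWalk_le hmeas hindep hident hL2 hmean hvar (4 ^ n)
      (by positivity)).trans ?_
    have h2 : ((3 : ℝ) * 2 ^ n) ^ 2 = 9 * 4 ^ n := by
      rw [mul_pow, ← pow_mul, mul_comm n 2, pow_mul]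
      norm_num
    rw [h2, div_le_iff₀ (by positivity)]
    push_cast
    nlinarith [pow_pos (show (0 : ℝ) < 4 by norm_num) n]
  have hcover : {ω | ¬ IsRegularPath (fun t => randomWalk X t ω) n k (3 * C * n)} ⊆
      {ω | ∃ t < 4 ^ n, 2 * (3 * 2 ^ n) < |randomWalk X t ω|} ∪
      ⋃ j ∈ Finset.range (n + 1), ⋃ s ∈ Finset.range (4 ^ n), bad j s := by
    intro ω hω
    by_contra hcon
    simp only [Set.mem_union, Set.mem_iUnion, not_or, not_exists, Finset.mem_range] at hcon
    refine hω ⟨fun t ht => ?_, fun j hj s hs => ?_⟩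
    · have h1 : ¬ ∃ t < 4 ^ n, 2 * (3 * 2 ^ n) < |randomWalk X t ω| := hcon.1
      push Not at h1
      linarith [h1 t ht]
    · have h1 : ¬ (3 * n) * (C * 2 ^ k) + 1 ≤ _ := hcon.2 j (by omega) s hs
      have h2 : 3 * C * n * 2 ^ k = (3 * n) * (C * 2 ^ k) := by ring
      omega
  have hunion : P.real (⋃ j ∈ Finset.range (n + 1), ⋃ s ∈ Finset.range (4 ^ n), bad j s) ≤
      (n + 1) * (4 ^ n * (1 / 2) ^ (3 * n)) := by
    refine (measureReal_biUnion_finset_le _ _).trans ?_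
    refine (Finset.sum_le_sum fun j _ => (measureReal_biUnion_finset_le _ _).trans
      (Finset.sum_le_sum fun s _ => hbadle j s)).trans (le_of_eq ?_)
    simp
  have hsmall : ((n : ℝ) + 1) * (4 ^ n * (1 / 2) ^ (3 * n)) ≤ 1 / 4 := by
    have h1 : (4 : ℝ) ^ n * (1 / 2) ^ (3 * n) = (1 / 2) ^ n := by
      rw [pow_mul, ← mul_pow]
      norm_num
    have h2 : ∀ m : ℕ, 5 ≤ m → 4 * (m + 1) ≤ 2 ^ m := by
      intro m hm
      induction m, hm using Nat.le_induction with
      | base => norm_num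
      | succ m hm ih =>
        rw [pow_succ]
        omega
    have h3 : (4 : ℝ) * (n + 1) ≤ 2 ^ n := by exact_mod_cast h2 n hn
    rw [h1, one_div, inv_pow, ← div_eq_mul_inv, div_le_iff₀ (by positivity)]
    linarith
  refine (measureReal_mono hcover (measure_ne_top _ _)).trans ?_
  refine (measureReal_union_le _ _).trans ?_
  linarith

end Regular

/-! ### Choice of the scale ratio and conclusion -/

section Conclusion

open Filter

/-- The ratio `k` between consecutive scales has to balance the factor `8 ^ k`, lost once, against
the factor `C * n`, lost at each of the `n / k` scales. -/
lemma eventually_mul_pow_le (C : ℕ) (hC : 0 < C) :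
    ∀ᶠ n : ℕ in atTop, ∃ k : ℕ, 0 < k ∧
      (n : ℝ) * (15 * 8 ^ k * ((C * n : ℕ) : ℝ) ^ (n / k)) ≤
        (2 : ℝ) ^ (4 * √((n : ℝ) * Real.logb 2 (n : ℝ))) := by
  have hlog : ∀ᶠ n : ℕ in atTop, ‖Real.log (n : ℝ)‖ ≤ 1 / 10 * ‖(n : ℝ) ^ (1 / 2 : ℝ)‖ :=
    tendsto_natCast_atTop_atTop.eventually
      ((isLittleO_log_rpow_atTop (r := 1 / 2) (by norm_num)).def (by norm_num))
  have hsqrt : ∀ᶠ n : ℕ in atTop, (70 : ℝ) ≤ √(n : ℝ) :=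
    (Real.tendsto_sqrt_atTop.comp tendsto_natCast_atTop_atTop).eventually_ge_atTop 70
  have hCn : ∀ᶠ n : ℕ in atTop, 10 * Real.logb 2 C ≤ Real.logb 2 (n : ℝ) :=
    ((Real.tendsto_logb_atTop one_lt_two).comp tendsto_natCast_atTop_atTop).eventually_ge_atTop _
  filter_upwards [hlog, hsqrt, hCn, eventually_ge_atTop 2] with n hlog hsqrt hCn hn
  have hn0 : (0 : ℝ) < n := by positivity
  have hn2 : (2 : ℝ) ≤ n := by exact_mod_cast hn
  set L := Real.logb 2 (n : ℝ) with hL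
  have hnL : (2 : ℝ) ^ L = n := Real.rpow_logb two_pos (by norm_num) hn0
  have hL1 : 1 ≤ L := by
    rw [hL, Real.le_logb_iff_rpow_le one_lt_two hn0]
    simpa using hn2
  set s := √((n : ℝ) * L) with hs
  have hs2 : s ^ 2 = n * L := Real.sq_sqrt (by positivity)
  have hsn : √(n : ℝ) ≤ s := Real.sqrt_le_sqrt (by nlinarith)
  have hs0 : 0 < s := by linarith
  have hLs : L + 7 ≤ 3 / 10 * s := by
    have h1 : Real.log n ≤ 1 / 10 * √(n : ℝ) := by
      rw [Real.norm_eq_abs, Real.norm_eq_abs, ← Real.sqrt_eq_rpow,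
        abs_of_nonneg (Real.sqrt_nonneg _)] at hlog
      exact (le_abs_self _).trans hlog
    have h2 : L ≤ 2 * Real.log n := by
      rw [hL, Real.logb, div_le_iff₀ (Real.log_pos one_lt_two)]
      have h3 : 0 ≤ Real.log n := Real.log_nonneg (by linarith)
      nlinarith [Real.log_two_gt_d9]
    linarith
  refine ⟨⌈s / 2⌉₊, Nat.ceil_pos.2 (by linarith), ?_⟩
  set k := ⌈s / 2⌉₊ with hk
  have hk1 : s / 2 ≤ k := Nat.le_ceil _
  have hk2 : (k : ℝ) ≤ s / 2 + 1 := (Nat.ceil_lt_add_one (by linarith)).le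
  have hk0 : (0 : ℝ) < k := by linarith
  have h8 : (8 : ℝ) ^ k ≤ 2 ^ (3 / 2 * s + 3) := by
    calc (8 : ℝ) ^ k = 2 ^ (3 * k : ℝ) := by
          rw [Real.rpow_mul two_pos.le, Real.rpow_natCast]
          norm_num
      _ ≤ 2 ^ (3 / 2 * s + 3) := Real.rpow_le_rpow_of_exponent_le one_le_two (by linarith)
  have hlam : ((C * n : ℕ) : ℝ) ^ (n / k) ≤ 2 ^ (22 / 10 * s) := by
    have h1 : ((C * n : ℕ) : ℝ) ≤ 2 ^ (11 / 10 * L) := by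
      have hC' : (C : ℝ) ≤ 2 ^ (1 / 10 * L) := by
        rw [← Real.logb_le_iff_le_rpow one_lt_two (by exact_mod_cast hC)]
        linarith
      rw [Nat.cast_mul, show 11 / 10 * L = 1 / 10 * L + L by ring, Real.rpow_add two_pos, hnL]
      exact mul_le_mul_of_nonneg_right hC' hn0.le
    have h2 : ((n / k : ℕ) : ℝ) ≤ 2 * (n / s) := by
      calc ((n / k : ℕ) : ℝ) ≤ n / k := Nat.cast_div_le
        _ ≤ n / (s / 2) := div_le_div_of_nonneg_left hn0.le (by linarith) hk1
        _ = 2 * (n / s) := by field_simp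
    calc ((C * n : ℕ) : ℝ) ^ (n / k) ≤ ((2 : ℝ) ^ (11 / 10 * L)) ^ (n / k) :=
          pow_le_pow_left₀ (by positivity) h1 _
      _ = 2 ^ (11 / 10 * L * ((n / k : ℕ) : ℝ)) := by
          rw [Real.rpow_mul_natCast two_pos.le]
      _ ≤ 2 ^ (22 / 10 * s) := by
          refine Real.rpow_le_rpow_of_exponent_le one_le_two ?_
          calc 11 / 10 * L * ((n / k : ℕ) : ℝ) ≤ 11 / 10 * L * (2 * (n / s)) :=
                mul_le_mul_of_nonneg_left h2 (by positivity)
            _ = 22 / 10 * (n * L / s) := by ring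
            _ = 22 / 10 * s := by
                rw [← hs2]
                field_simp
  have h15 : (15 : ℝ) ≤ 2 ^ (4 : ℝ) := by norm_num
  calc (n : ℝ) * (15 * 8 ^ k * ((C * n : ℕ) : ℝ) ^ (n / k))
      ≤ 2 ^ L * (2 ^ (4 : ℝ) * 2 ^ (3 / 2 * s + 3) * 2 ^ (22 / 10 * s)) := by
        rw [hnL]
        gcongr
    _ = 2 ^ (L + (4 + (3 / 2 * s + 3) + 22 / 10 * s)) := by
        simp only [Real.rpow_add two_pos]
    _ ≤ 2 ^ (4 * s) := Real.rpow_le_rpow_of_exponent_le one_le_two (by linarith)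

variable {Ω : Type*} [MeasurableSpace Ω] {P : Measure Ω} [IsProbabilityMeasure P] {X : ℕ → Ω → ℝ}

/-- The bound at a length smaller by a factor `n` holds with probability `1 / 2`; submultiplicativity
of the tail turns this into `2 ^ (-n)`. No exponential moment enters. -/
lemma eventually_measureReal_le_LIS_le
    (hmeas : ∀ i, Measurable (X i)) (hindep : iIndepFun X P)
    (hident : ∀ i, IdentDistrib (X i) (X 0) P P)
    (hL2 : MemLp (X 0) 2 P) (hmean : ∫ ω, X 0 ω ∂P = 0) (hvar : variance (X 0) P = 1) :
    ∀ᶠ n : ℕ in atTop, ∀ ℓ : ℕ,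
      P.real {ω | (ℓ : ℝ) * (2 : ℝ) ^ ((n : ℝ) + 4 * √((n : ℝ) * Real.logb 2 (n : ℝ)))
          ≤ (LIS (fun j => randomWalk X j ω) (Finset.range (4 ^ n)) : ℝ)}
        ≤ ((1 / 2) ^ n) ^ ℓ := by
  obtain ⟨C, hC, hreg⟩ :=
    exists_measureReal_not_isRegularPath_le hmeas hindep hident hL2 hmean hvar
  filter_upwards [eventually_mul_pow_le C hC, eventually_ge_atTop 5] with n hn hn5 ℓ
  obtain ⟨k, hk, hbound⟩ := hn
  set y : ℝ := (2 : ℝ) ^ ((n : ℝ) + 4 * √((n : ℝ) * Real.logb 2 (n : ℝ))) with hy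
  have hlam : 2 ≤ C * n := by nlinarith
  have hlam' : (0 : ℝ) < ((C * n : ℕ) : ℝ) := Nat.cast_pos.2 (by omega)
  -- The factor `15` makes `x` strictly larger than the deterministic bound, which has `14`.
  set x : ℝ := 15 * 2 ^ n * 8 ^ k * ((C * n : ℕ) : ℝ) ^ (n / k) with hx
  have hxpos : 0 < x := by positivity
  have hxy : n * x ≤ y := by
    rw [hy, Real.rpow_add two_pos, Real.rpow_natCast, hx]
    calc (n : ℝ) * (15 * 2 ^ n * 8 ^ k * ((C * n : ℕ) : ℝ) ^ (n / k))
        = 2 ^ n * (n * (15 * 8 ^ k * ((C * n : ℕ) : ℝ) ^ (n / k))) := by ring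
      _ ≤ _ := mul_le_mul_of_nonneg_left hbound (by positivity)
  have hhalf : P.real {ω | x ≤ (LIS (fun j => randomWalk X j ω) (Finset.range (4 ^ n)) : ℝ)} ≤
      1 / 2 := by
    refine (measureReal_mono ?_ (measure_ne_top _ _)).trans (hreg n k hn5)
    intro ω hω hcon
    have h1 : x ≤ _ := hω
    have h2 : (LIS (fun j => randomWalk X j ω) (Finset.range (4 ^ n)) : ℝ) ≤
        14 * 2 ^ n * 8 ^ k * ((C * n : ℕ) : ℝ) ^ (n / k) := by
      exact_mod_cast hcon.LIS_le hlam hk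
    have h3 : 14 * 2 ^ n * 8 ^ k * ((C * n : ℕ) : ℝ) ^ (n / k) < x := by
      rw [hx]
      gcongr
      norm_num
    linarith
  refine (measureReal_le_LIS_pow hmeas hindep (4 ^ n) (by positivity) ℓ).trans ?_
  refine pow_le_pow_left₀ measureReal_nonneg ?_ ℓ
  refine le_trans (measureReal_mono ?_ (measure_ne_top _ _))
    ((measureReal_le_LIS_pow hmeas hindep (4 ^ n) hxpos n).trans
      (pow_le_pow_left₀ measureReal_nonneg hhalf n))
  exact fun ω hω => hxy.trans hω

lemma sq_le_two_pow_succ (n : ℕ) : n ^ 2 ≤ 2 ^ (n + 1) := by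
  induction n with
  | zero => norm_num
  | succ n ih =>
    rcases le_or_gt n 2 with h | h
    · interval_cases n <;> norm_num
    · rw [pow_succ 2 (n + 1)]
      nlinarith

end Conclusion

end RandomWalkLIS

theorem mainTheorem1 {Ω : Type*} [MeasurableSpace Ω] (P : Measure Ω) [IsProbabilityMeasure P]
    (X : ℕ → Ω → ℝ) (hmeas : ∀ i, Measurable (X i)) (hindep : iIndepFun X P)
    (hident : ∀ i, IdentDistrib (X i) (X 0) P P)
    (hL2 : MemLp (X 0) 2 P) (hmean : ∫ ω, X 0 ω ∂P = 0) (hvar : variance (X 0) P = 1) :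
    (∃ n₀ : ℕ, ∀ n : ℕ, n₀ ≤ n → ∀ ℓ : ℕ, 1 ≤ ℓ →
      P.real {ω | (ℓ : ℝ) * (2 : ℝ) ^ ((n : ℝ) + 4 * √((n : ℝ) * Real.logb 2 (n : ℝ)))
          ≤ (LIS (fun j => randomWalk X j ω) (Finset.range (4 ^ n)) : ℝ)}
        ≤ (2 / (n : ℝ) ^ 2) ^ ℓ) ∧
    ((∃ t : ℝ, 0 < t ∧ Integrable (fun ω => Real.exp (t * |X 0 ω|)) P) →
      ∃ n₀ : ℕ, ∀ n : ℕ, n₀ ≤ n → ∀ ℓ : ℕ, 1 ≤ ℓ →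
        P.real {ω | (ℓ : ℝ) * (2 : ℝ) ^ ((n : ℝ) + 4 * √((n : ℝ) * Real.logb 2 (n : ℝ)))
            ≤ (LIS (fun j => randomWalk X j ω) (Finset.range (4 ^ n)) : ℝ)}
          ≤ (2 : ℝ) ^ (-((ℓ : ℝ) * (n : ℝ)))) := by
  obtain ⟨n₀, hn₀⟩ := Filter.eventually_atTop.1
    (RandomWalkLIS.eventually_measureReal_le_LIS_le hmeas hindep hident hL2 hmean hvar)
  refine ⟨⟨max n₀ 1, fun n hn ℓ _ => ?_⟩, fun _ => ⟨n₀, fun n hn ℓ _ => ?_⟩⟩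
  · refine (hn₀ n (le_of_max_le_left hn) ℓ).trans (pow_le_pow_left₀ (by positivity) ?_ ℓ)
    have h1 : (0 : ℝ) < n := Nat.cast_pos.2 (le_of_max_le_right hn)
    have h2 : (n : ℝ) ^ 2 ≤ 2 ^ (n + 1) := by
      exact_mod_cast RandomWalkLIS.sq_le_two_pow_succ n
    rw [one_div, inv_pow, inv_eq_one_div, div_le_div_iff₀ (by positivity) (by positivity)]
    rw [pow_succ 2 n] at h2
    linarith
  · refine (hn₀ n hn ℓ).trans (le_of_eq ?_)
    rw [← pow_mul, mul_comm n ℓ, one_div, inv_pow, Real.rpow_neg two_pos.le, ← Nat.cast_mul,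
      Real.rpow_natCast]
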